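/- Let $A$ be a (unital, associative) ring and let $S\subseteq A$ be a left denominator set, i.e. a multiplicatively closed subset containing $1$ such that (a) for all $a\in A$, $s\in S$ there are $a'\in A$, $s'\in S$ with $s'a=a's$, and (b) if $as=0$ with $a\in A$, $s\in S$, then $s'a=0$ for some $s'\in S$. All modules are left $A$-modules; $M_S$ denotes the left Ore localisation of $M$ at $S$, and $D(A)$ the unbounded derived category of left $A$-modules. Let $\mathcal T_S$ be the torsion class of modules $M$ such that every $m\in M$ is annihilated by some $s\in S$, and let $\Gamma_S(M)=\{m\in M \mid sm=0 \text{ for some } s\in S\}$ be the associated torsion functor, with inclusion $\sigma:\Gamma_S\to\mathrm{id}$, right derived functor $\mathrm R\Gamma_S:D(A)\to D(A)$, induced morphism $\sigma^{\mathrm R}:\mathrm R\Gamma_S\to\mathrm{id}_{D(A)}$, and $\mathrm R^i\Gamma_S:=\mathrm H^i(\mathrm R\Gamma_S)$ on modules. A module $M$ is called right $\Gamma_S$-acyclic if $\mathrm R^i\Gamma_S(M)=0$ for all $i\ge 1$; $\mathcal T_S$ is called weakly stable if $\Gamma_S(E)$ is right $\Gamma_S$-acyclic for every injective module $E$; and the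 (right) cohomological dimension of $\Gamma_S$ is $\sup\{i\in\mathbb N \mid \mathrm R^i\Gamma_S\neq 0\}$. Let $\mathrm K(A;S)=(\cdots\to 0\to A\to A_S\to 0\to\cdots)$ be the complex of $A$-bimodules with $A$ in degree $0$, $A_S$ in degree $1$ and the localisation map as differential, and let $e:\mathrm K(A;S)\to A$ be the morphism of complexes that is the identity of $A$ in degree $0$. Let $\nu:\mathrm R\Gamma_S\to \mathrm K(A;S)\otimes^{\mathrm L}_A(-)$ be the unique morphism of functors $D(A)\to D(A)$ with $(e\otimes^{\mathrm L}_A\mathrm{id}_M)\circ\nu_M=\sigma^{\mathrm R}_M$ for all $M\in D(A)$. Then the following are equivalent: (i) the torsion class $\mathcal T_S$ is weakly stable; (ii) for every right $\Gamma_S$-acyclic module $M$, the canonical map $M\to M_S$ is surjective; (iii) for every injective module $E$, the canonical map $E\to E_S$ is surjective; (iv) $\nu:\mathrm R\Gamma_S\to \mathrm K(A;S)\otimes^{\mathrm L}_A(-)$ is an isomorphism of functors; (v) $\Gamma_S$ has cohomological dimension at most $1$. -/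

import Mathlib

open CategoryTheory CategoryTheory.Limits
open scoped TensorProduct

universe w v u

noncomputable section

namespace OreTorsion

section TorsionClasses

variable {A : Type u} [Ring A]

/-- A (hereditary) torsion class in the category of left `A`-modules: a class of modules containing
the zero module and closed under submodules, quotients and extensions (a Serre class), which is also
closed under arbitrary direct sums. -/
class IsTorsionClass (T : ObjectProperty (ModuleCat.{u} A)) : Prop extends T.IsSerreClass where
  closedUnderDirectSums : ∀ J : Type u, T.IsClosedUnderColimitsOfShape (Discrete J)

/-- The largest submodule of `M` lying in the class `T`. -/
def torsionSubmodule (T : ObjectProperty (ModuleCat.{u} A)) (M : ModuleCat.{u} A) :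
    Submodule A M :=
  sSup {N : Submodule A M | T (ModuleCat.of A N)}

lemma torsionSubmodule_map_le (T : ObjectProperty (ModuleCat.{u} A)) [IsTorsionClass T]
    {M N : ModuleCat.{u} A} (f : M ⟶ N) :
    (torsionSubmodule T M).map f.hom ≤ torsionSubmodule T N := by
  rw [torsionSubmodule, Submodule.map_le_iff_le_comap]
  refine sSup_le fun P hP => ?_
  rw [← Submodule.map_le_iff_le_comap]
  refine le_sSup ?_
  let g : ModuleCat.of A P ⟶ ModuleCat.of A (P.map f.hom) :=
    ModuleCat.ofHom (f.hom.submoduleMap P)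
  have : Epi g := (ModuleCat.epi_iff_surjective g).2 (f.hom.submoduleMap_surjective P)
  exact T.prop_of_epi g hP

/-- The torsion functor `Γ_T` of a torsion class `T`. -/
def torsionFunctor (T : ObjectProperty (ModuleCat.{u} A)) [IsTorsionClass T] :
    ModuleCat.{u} A ⥤ ModuleCat.{u} A where
  obj M := ModuleCat.of A (torsionSubmodule T M)
  map {M N} f := ModuleCat.ofHom (f.hom.restrict fun m hm =>
    torsionSubmodule_map_le T f (Submodule.mem_map_of_mem hm))

instance (T : ObjectProperty (ModuleCat.{u} A)) [IsTorsionClass T] :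
    (torsionFunctor T).Additive where
  map_add := rfl

/-- The canonical inclusion `σ : Γ_T ⟶ id`. -/
def torsionInclusion (T : ObjectProperty (ModuleCat.{u} A)) [IsTorsionClass T] :
    torsionFunctor T ⟶ 𝟭 (ModuleCat.{u} A) where
  app M := ModuleCat.ofHom (torsionSubmodule T M).subtype

instance enoughInjectives : EnoughInjectives (ModuleCat.{u} A) :=
  ModuleCat.enoughInjectives.{u, u} A

/-- A module `M` is right `F`-acyclic if `R^i F (M) = 0` for all `i ≥ 1`. -/
def IsRightAcyclic (F : ModuleCat.{u} A ⥤ ModuleCat.{u} A) [F.Additive]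
    (M : ModuleCat.{u} A) : Prop :=
  ∀ i : ℕ, 1 ≤ i → IsZero ((F.rightDerived i).obj M)

/-- The right cohomological dimension `sup {i | R^i F ≠ 0}`. -/
def rightCohomologicalDimension (F : ModuleCat.{u} A ⥤ ModuleCat.{u} A) [F.Additive] : ℕ∞ :=
  ⨆ (i : ℕ) (_ : ¬ IsZero (F.rightDerived i)), (i : ℕ∞)

/-- A torsion class `T` is weakly stable if `Γ_T E` is right `Γ_T`-acyclic for every injective
module `E`. -/
def IsWeaklyStable (T : ObjectProperty (ModuleCat.{u} A)) [IsTorsionClass T] : Prop :=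
  ∀ E : ModuleCat.{u} A, Injective E → IsRightAcyclic (torsionFunctor T) ((torsionFunctor T).obj E)

end TorsionClasses

section OreSets

variable {A : Type u} [Ring A] (S : Submonoid A)

/-- The class `T_S` of the modules all of whose elements are annihilated by an element of `S`. -/
def oreTorsionClass : ObjectProperty (ModuleCat.{u} A) :=
  fun M => ∀ m : M, ∃ s ∈ S, s • m = 0

variable [OreLocalization.OreSet S]

/-- The elements of `M` annihilated by an element of `S` form a submodule. -/
def annihilatedSubmodule (M : Type*) [AddCommGroup M] [Module A M] : Submodule A M where
  carrier := {m | ∃ s ∈ S, s • m = 0}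
  zero_mem' := ⟨1, S.one_mem, smul_zero _⟩
  add_mem' := by
    rintro a b ⟨s, hs, ha⟩ ⟨t, ht, hb⟩
    have h := OreLocalization.ore_eq s (⟨t, ht⟩ : S)
    refine ⟨OreLocalization.oreDenom s (⟨t, ht⟩ : S) * s,
      S.mul_mem (SetLike.coe_mem _) hs, ?_⟩
    rw [smul_add, mul_smul, ha, smul_zero, zero_add, h]
    simp [mul_smul, hb]
  smul_mem' := by
    rintro r m ⟨s, hs, hm⟩
    have h := OreLocalization.ore_eq r (⟨s, hs⟩ : S)
    refine ⟨OreLocalization.oreDenom r (⟨s, hs⟩ : S), SetLike.coe_mem _, ?_⟩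
    rw [smul_smul, h]
    simp [mul_smul, hm]

instance : IsTorsionClass (oreTorsionClass S) where
  exists_zero := ⟨ModuleCat.of A PUnit, ModuleCat.isZero_of_subsingleton _,
    fun m => ⟨1, S.one_mem, Subsingleton.elim _ _⟩⟩
  prop_of_mono f _ hY m := by
    obtain ⟨s, hs, h⟩ := hY (f m)
    refine ⟨s, hs, (ModuleCat.mono_iff_injective f).1 inferInstance ?_⟩
    simpa using h
  prop_of_epi f _ hX m := by
    obtain ⟨x, rfl⟩ := (ModuleCat.epi_iff_surjective f).1 inferInstance m
    obtain ⟨s, hs, h⟩ := hX x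
    exact ⟨s, hs, by rw [← map_smul, h, map_zero]⟩
  prop_X₂_of_shortExact {E} hE h₁ h₃ m := by
    obtain ⟨s, hs, h⟩ := h₃ (E.g m)
    rw [← map_smul] at h
    obtain ⟨x, hx⟩ := (ShortComplex.moduleCat_exact_iff E).1 hE.exact _ h
    obtain ⟨t, ht, h'⟩ := h₁ x
    refine ⟨t * s, S.mul_mem ht hs, ?_⟩
    rw [mul_smul, ← hx, ← map_smul, h', map_zero]
  closedUnderDirectSums J := ⟨by
    rintro M ⟨p⟩ m
    have hz : ModuleCat.ofHom (annihilatedSubmodule S M).mkQ = 0 :=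
      p.isColimit.hom_ext fun j => by
        ext x
        obtain ⟨s, hs, h⟩ := p.prop_diag_obj j x
        refine (Submodule.Quotient.mk_eq_zero _).2 ⟨s, hs, ?_⟩
        rw [← map_smul, h, map_zero]
    have h0 : (annihilatedSubmodule S M).mkQ m = 0 := by
      have := congrArg (fun g => g.hom m) hz
      simpa using this
    exact (Submodule.Quotient.mk_eq_zero _).1 h0⟩

/-- The torsion functor `Γ_S`. -/
abbrev oreTorsionFunctor : ModuleCat.{u} A ⥤ ModuleCat.{u} A :=
  torsionFunctor (oreTorsionClass S)

lemma mem_torsionSubmodule_iff (M : ModuleCat.{u} A) (m : M) :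
    m ∈ torsionSubmodule (oreTorsionClass S) M ↔ ∃ s ∈ S, s • m = 0 := by
  suffices h : torsionSubmodule (oreTorsionClass S) M = annihilatedSubmodule S M by
    rw [h]; rfl
  refine le_antisymm (sSup_le fun N hN n hn => ?_) (le_sSup fun n => ?_)
  · obtain ⟨s, hs, h⟩ := hN (⟨n, hn⟩ : N)
    exact ⟨s, hs, congrArg Subtype.val h⟩
  · obtain ⟨s, hs, h⟩ := n.2
    exact ⟨s, hs, Subtype.ext h⟩

/-- The canonical localisation map `M → M_S`, `m ↦ 1⁻¹ m`, into the left Ore localisation. -/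
def toLocalization (M : ModuleCat.{u} A) (m : M) : OreLocalization S M :=
  OreLocalization.oreDiv m 1

end OreSets

section TensorProducts

variable (𝕂 : Type v) [CommRing 𝕂] {A : Type u} [Ring A] [Algebra 𝕂 A]

/-- The category of `A`-bimodules (with central action of `𝕂`), as left modules over the enveloping
algebra `A ⊗ Aᵒᵖ`. -/
abbrev BimodCat (A : Type u) [Ring A] [Algebra 𝕂 A] := ModuleCat.{u} (A ⊗[𝕂] Aᵐᵒᵖ)

/-- The left `A`-module underlying an `A`-bimodule. -/
abbrev leftModule : BimodCat 𝕂 A ⥤ ModuleCat.{u} A :=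
  ModuleCat.restrictScalars
    (Algebra.TensorProduct.includeLeftRingHom : A →+* A ⊗[𝕂] Aᵐᵒᵖ)

variable {𝕂}

/-- The right action `n · a` of `A` on an `A`-bimodule. -/
def rightMul (N : BimodCat 𝕂 A) (n : N) (a : A) : N :=
  ((1 : A) ⊗ₜ[𝕂] MulOpposite.op a) • n

/-- The pure tensor `n ⊗ m` in `N ⊗_ℤ M`. -/
abbrev intTmul (N : BimodCat 𝕂 A) (M : ModuleCat.{u} A) (n : N) (m : M) :
    (leftModule 𝕂).obj N ⊗[ℤ] M :=
  TensorProduct.tmul ℤ (M := (leftModule 𝕂).obj N) n m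

/-- The submodule of `N ⊗_ℤ M` generated by the elements `(n · a) ⊗ m - n ⊗ (a m)`. -/
def balancing (N : BimodCat 𝕂 A) (M : ModuleCat.{u} A) :
    Submodule A ((leftModule 𝕂).obj N ⊗[ℤ] M) :=
  Submodule.span A {x | ∃ (n : N) (a : A) (m : M),
    x = intTmul N M (rightMul N n a) m - intTmul N M n (a • m)}

/-- The left `A`-module `N ⊗_A M`, for a bimodule `N` and a left module `M`. -/
abbrev tensorObj (N : BimodCat 𝕂 A) (M : ModuleCat.{u} A) : ModuleCat.{u} A :=
  ModuleCat.of A (((leftModule 𝕂).obj N ⊗[ℤ] M) ⧸ balancing N M)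

/-- The element `n ⊗ m` of `N ⊗_A M`. -/
def tmul {N : BimodCat 𝕂 A} {M : ModuleCat.{u} A} (n : N) (m : M) : tensorObj N M :=
  (balancing N M).mkQ (intTmul N M n m)

lemma tensor_hom_ext {N : BimodCat 𝕂 A} {M P : ModuleCat.{u} A} {f g : tensorObj N M ⟶ P}
    (h : ∀ (n : N) (m : M), f (tmul n m) = g (tmul n m)) : f = g := by
  ext : 1
  refine Submodule.linearMap_qext _ ?_
  refine TensorProduct.AlgebraTensorModule.ext fun n m => h n m

/-- The map `f ⊗ g : N ⊗_A M ⟶ N' ⊗_A M'`. -/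
def tensorMap {N N' : BimodCat 𝕂 A} {M M' : ModuleCat.{u} A} (f : N ⟶ N') (g : M ⟶ M') :
    tensorObj N M ⟶ tensorObj N' M' :=
  ModuleCat.ofHom <| Submodule.mapQ _ _
    (TensorProduct.AlgebraTensorModule.map ((leftModule 𝕂).map f).hom
      (g.hom.toAddMonoidHom.toIntLinearMap)) <| by
    rw [balancing, Submodule.span_le]
    rintro _ ⟨n, a, m, rfl⟩
    refine Submodule.subset_span ⟨f n, a, g m, ?_⟩
    have h₁ : f (rightMul N n a) = rightMul N' (f n) a := f.hom.map_smul _ _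
    have h₂ : g (a • m) = a • g m := g.hom.map_smul _ _
    rw [map_sub, ← h₁, ← h₂]
    rfl

@[simp]
lemma tensorMap_tmul {N N' : BimodCat 𝕂 A} {M M' : ModuleCat.{u} A} (f : N ⟶ N') (g : M ⟶ M')
    (n : N) (m : M) : tensorMap f g (tmul n m) = tmul (f n) (g m) := rfl

variable (𝕂 A) in
/-- The bifunctor `(N, M) ↦ N ⊗_A M`. -/
def tensorBifunctor : BimodCat 𝕂 A ⥤ ModuleCat.{u} A ⥤ ModuleCat.{u} A where
  obj N :=
    { obj M := tensorObj N M
      map g := tensorMap (𝟙 N) g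
      map_id M := tensor_hom_ext fun _ _ => rfl
      map_comp f g := tensor_hom_ext fun _ _ => rfl }
  map f :=
    { app M := tensorMap f (𝟙 M)
      naturality M M' g := tensor_hom_ext fun _ _ => rfl }
  map_id N := by
    ext M : 2
    exact tensor_hom_ext fun _ _ => rfl
  map_comp f g := by
    ext M : 2
    exact tensor_hom_ext fun _ _ => rfl

instance : (tensorBifunctor 𝕂 A).PreservesZeroMorphisms where
  map_zero N N' := by
    ext M : 2
    refine tensor_hom_ext fun n m => ?_
    have : intTmul N' M (0 : N') m = 0 := TensorProduct.zero_tmul _ _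
    exact (congrArg (balancing N' M).mkQ this).trans (map_zero _)

instance (N : BimodCat 𝕂 A) : ((tensorBifunctor 𝕂 A).obj N).PreservesZeroMorphisms where
  map_zero M M' := by
    refine tensor_hom_ext fun n m => ?_
    have : intTmul N M' n (0 : M') = 0 := TensorProduct.tmul_zero _ _
    exact (congrArg (balancing N M').mkQ this).trans (map_zero _)

/-- For a complex `K` of `A`-bimodules, the functor `K ⊗_A (-)` on complexes of left `A`-modules:
`(K ⊗_A M)^n` is the direct sum of the `K^p ⊗_A M^q` for `p + q = n`, and the differential is
`d ⊗ 1 + (-1)^p (1 ⊗ d)`. -/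
def complexTensor (K : CochainComplex (BimodCat 𝕂 A) ℤ) :
    CochainComplex (ModuleCat.{u} A) ℤ ⥤ CochainComplex (ModuleCat.{u} A) ℤ :=
  (tensorBifunctor 𝕂 A).map₂CochainComplex.obj K

/-- The natural transformation `K ⊗_A (-) ⟶ L ⊗_A (-)` induced by a morphism `K ⟶ L` of complexes
of bimodules. -/
def complexTensorMap {K L : CochainComplex (BimodCat 𝕂 A) ℤ} (f : K ⟶ L) :
    complexTensor K ⟶ complexTensor L :=
  (tensorBifunctor 𝕂 A).map₂CochainComplex.map f

variable (𝕂 A) in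
/-- The ring `A` as an `A`-bimodule. -/
def regularBimod : BimodCat 𝕂 A :=
  letI : Module (A ⊗[𝕂] Aᵐᵒᵖ) A := TensorProduct.Algebra.module
  ModuleCat.of (A ⊗[𝕂] Aᵐᵒᵖ) A

lemma regularBimod_smul (a b x : A) :
    ((a ⊗ₜ[𝕂] MulOpposite.op b) • (show regularBimod 𝕂 A from x)) = (a * x * b : A) := by
  let _ : Module (A ⊗[𝕂] Aᵐᵒᵖ) A := TensorProduct.Algebra.module
  refine (TensorProduct.Algebra.smul_def a (MulOpposite.op b) x).trans ?_
  simp [mul_assoc]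

variable (𝕂 A) in
/-- The ring `A` as a complex of bimodules in degree zero. -/
abbrev regularComplex : CochainComplex (BimodCat 𝕂 A) ℤ :=
  (HomologicalComplex.single (BimodCat 𝕂 A) (ComplexShape.up ℤ) 0).obj (regularBimod 𝕂 A)

/-- The action of `A` on a left module, as a balanced map. -/
def actionMap (M : ModuleCat.{u} A) :
    ((leftModule 𝕂).obj (regularBimod 𝕂 A) ⊗[ℤ] M) →ₗ[A] M :=
  TensorProduct.AlgebraTensorModule.lift
    { toFun := fun a => (DistribSMul.toAddMonoidHom M (show A from a)).toIntLinearMap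
      map_add' := fun a b => by
        ext m
        exact add_smul (show A from a) (show A from b) m
      map_smul' := fun a b => by
        ext m
        refine (congrArg (fun c : A => c • m) (regularBimod_smul (𝕂 := 𝕂) a 1 b)).trans ?_
        have h (p q : A) (m : M) : (p * q * 1) • m = p • q • m := by rw [mul_one, mul_smul]
        exact h a b m }

lemma balancing_le_ker_actionMap (M : ModuleCat.{u} A) :
    balancing (regularBimod 𝕂 A) M ≤ LinearMap.ker (actionMap (𝕂 := 𝕂) M) := by
  rw [balancing, Submodule.span_le]
  rintro _ ⟨n, a, m, rfl⟩
  have h : (show A from rightMul (regularBimod 𝕂 A) n a) • m = (show A from n) • (a • m) := by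
    refine (congrArg (fun c : A => c • m) (regularBimod_smul (𝕂 := 𝕂) 1 a n)).trans ?_
    have h (p q : A) (m : M) : (1 * p * q) • m = p • q • m := by rw [one_mul, mul_smul]
    exact h n a m
  refine (map_sub (actionMap (𝕂 := 𝕂) M) _ _).trans ?_
  rw [sub_eq_zero]
  exact h

variable (𝕂 A) in
/-- The canonical map `A ⊗_A M ⟶ M`, `a ⊗ m ↦ a m`. -/
def tensorUnit : (tensorBifunctor 𝕂 A).obj (regularBimod 𝕂 A) ⟶ 𝟭 (ModuleCat.{u} A) where
  app M := ModuleCat.ofHom (Submodule.liftQ _ (actionMap M) (balancing_le_ker_actionMap M))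
  naturality _ _ g := tensor_hom_ext fun a m => (g.hom.map_smul (show A from a) m).symm

lemma tensorUnit_tmul (M : ModuleCat.{u} A) (a : A) (m : M) :
    (tensorUnit 𝕂 A).app M (tmul (show regularBimod 𝕂 A from a) m) = a • m := rfl

/-- The component `A^p ⊗_A M^q ⟶ M^n` of the canonical map `A ⊗_A M ⟶ M`, for `A` regarded as a
complex in degree zero: it is `a ⊗ m ↦ a m` for `p = 0`, and zero otherwise. -/
def complexTensorUnitComponent (M : CochainComplex (ModuleCat.{u} A) ℤ) (n p q : ℤ)
    (h : p + q = n) :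
    ((tensorBifunctor 𝕂 A).obj ((regularComplex 𝕂 A).X p)).obj (M.X q) ⟶ M.X n :=
  if hp : p = 0 then
    ((tensorBifunctor 𝕂 A).map (HomologicalComplex.singleObjXIsoOfEq _ 0 _ p hp).hom).app (M.X q) ≫
      (tensorUnit 𝕂 A).app (M.X q) ≫ (M.XIsoOfEq (by omega)).hom
  else 0

lemma complexTensorUnitComponent_comp_d (M : CochainComplex (ModuleCat.{u} A) ℤ) (n n' q : ℤ)
    (hn : n + 1 = n') (h : 0 + q = n) :
    complexTensorUnitComponent (𝕂 := 𝕂) M n 0 q h ≫ M.d n n' =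
      ((tensorBifunctor 𝕂 A).obj ((regularComplex 𝕂 A).X 0)).map (M.d q (q + 1)) ≫
        complexTensorUnitComponent (𝕂 := 𝕂) M n' 0 (q + 1) (by omega) := by
  obtain rfl : q = n := by omega
  obtain rfl : q + 1 = n' := by omega
  simp [complexTensorUnitComponent]

variable (𝕂) in
/-- The canonical map `A ⊗_A M ⟶ M` for a complex `M`. -/
def complexTensorUnitApp (M : CochainComplex (ModuleCat.{u} A) ℤ) :
    HomologicalComplex.mapBifunctor (regularComplex 𝕂 A) M (tensorBifunctor 𝕂 A)
      (ComplexShape.up ℤ) ⟶ M where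
  f n := HomologicalComplex.mapBifunctorDesc (complexTensorUnitComponent M n)
  comm' n n' hn := by
    refine HomologicalComplex.mapBifunctor.hom_ext fun p q h => ?_
    rw [HomologicalComplex.ι_mapBifunctorDesc_assoc, HomologicalComplex.mapBifunctor.d_eq,
      Preadditive.add_comp, Preadditive.comp_add,
      HomologicalComplex.mapBifunctor.ι_D₁_assoc, HomologicalComplex.mapBifunctor.ι_D₂_assoc]
    by_cases hp : p = 0
    · subst hp
      have h₁ : HomologicalComplex.mapBifunctor.d₁ (regularComplex 𝕂 A) M (tensorBifunctor 𝕂 A)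
          (ComplexShape.up ℤ) 0 q n' = 0 := by
        rw [HomologicalComplex.mapBifunctor.d₁_eq' _ _ _ _ (show (ComplexShape.up ℤ).Rel 0 1 from rfl),
          HomologicalComplex.single_obj_d, Functor.map_zero, zero_app, zero_comp, smul_zero]
      have hn' : n + 1 = n' := hn
      have h' : 0 + q = n := h
      rw [h₁, zero_comp, zero_add, complexTensorUnitComponent_comp_d M n n' q hn' h',
        HomologicalComplex.mapBifunctor.d₂_eq _ _ _ _ _
          (show (ComplexShape.up ℤ).Rel q (q + 1) from rfl) _
          (show 0 + (q + 1) = n' by omega)]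
      simp
    · have h0 : IsZero ((regularComplex 𝕂 A).X p) :=
        HomologicalComplex.isZero_single_obj_X _ _ _ _ hp
      refine IsZero.eq_of_src ?_ _ _
      rw [IsZero.iff_id_eq_zero]
      have := congrArg (fun f => ((tensorBifunctor 𝕂 A).map f).app (M.X q)) (h0.eq_of_src (𝟙 _) 0)
      simpa using this

lemma complexTensorUnitApp_naturality {M M' : CochainComplex (ModuleCat.{u} A) ℤ} (g : M ⟶ M') :
    HomologicalComplex.mapBifunctorMap (𝟙 (regularComplex 𝕂 A)) g (tensorBifunctor 𝕂 A)
      (ComplexShape.up ℤ) ≫ complexTensorUnitApp 𝕂 M' = complexTensorUnitApp 𝕂 M ≫ g := by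
  ext n : 1
  refine HomologicalComplex.mapBifunctor.hom_ext fun p q h => ?_
  rw [HomologicalComplex.comp_f, HomologicalComplex.comp_f,
    HomologicalComplex.ι_mapBifunctorMap_assoc]
  dsimp only [complexTensorUnitApp]
  rw [HomologicalComplex.ι_mapBifunctorDesc, HomologicalComplex.ι_mapBifunctorDesc_assoc]
  by_cases hp : p = 0
  · subst hp
    have h' : 0 + q = n := h
    obtain rfl : q = n := by omega
    simp [complexTensorUnitComponent]
  · simp [complexTensorUnitComponent, hp]

variable (𝕂 A) in
/-- The canonical map `A ⊗_A M ⟶ M` for complexes, as a natural transformation. -/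
def complexTensorUnit :
    complexTensor (regularComplex 𝕂 A) ⟶ 𝟭 (CochainComplex (ModuleCat.{u} A) ℤ) where
  app M := complexTensorUnitApp 𝕂 M
  naturality _ _ g := complexTensorUnitApp_naturality g

end TensorProducts

section LocalizationComplex

variable (𝕂 : Type v) [CommRing 𝕂] {A : Type u} [Ring A] [Algebra 𝕂 A]
  (S : Submonoid A) [OreLocalization.OreSet S]

/-- The localisation map `A → A_S` as a homomorphism of `𝕂`-algebras. -/
def localizationHom : A →ₐ[𝕂] OreLocalization S A where
  __ := (OreLocalization.numeratorRingHom : A →+* OreLocalization S A)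
  commutes' _ := rfl

/-- The ring `A_S` as an `A`-bimodule, by restriction along `A → A_S`. -/
def localizedBimod : BimodCat 𝕂 A :=
  (ModuleCat.restrictScalars (Algebra.TensorProduct.map (localizationHom 𝕂 S)
    (AlgHom.op (localizationHom 𝕂 S))).toRingHom).obj
    (regularBimod 𝕂 (OreLocalization S A))

/-- The localisation map `A → A_S`, as an additive map between bimodules. -/
def localizationAddHom : regularBimod 𝕂 A →+ localizedBimod 𝕂 S :=
  (localizationHom 𝕂 S : A →+ OreLocalization S A)

lemma localizationAddHom_smul (x : A ⊗[𝕂] Aᵐᵒᵖ) (a : regularBimod 𝕂 A) :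
    localizationAddHom 𝕂 S (x • a) = x • localizationAddHom 𝕂 S a := by
  induction x using TensorProduct.induction_on with
  | zero =>
    have h {R : Type u} [Ring R] (M : ModuleCat.{u} R) (m : M) : (0 : R) • m = 0 := zero_smul R m
    exact (congrArg (localizationAddHom 𝕂 S) (h _ a)).trans
      ((map_zero _).trans (h (localizedBimod 𝕂 S) _).symm)
  | add x y hx hy => rw [add_smul, add_smul, map_add, hx, hy]
  | tmul b c =>
    refine (congrArg (localizationAddHom 𝕂 S) (regularBimod_smul b c.unop a)).trans ?_
    have h (p q r : A) : localizationHom 𝕂 S (p * q * r) =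
      localizationHom 𝕂 S p * localizationHom 𝕂 S q * localizationHom 𝕂 S r := by
      rw [map_mul, map_mul]
    exact (h b a c.unop).trans (regularBimod_smul (𝕂 := 𝕂) (localizationHom 𝕂 S b)
      (localizationHom 𝕂 S c.unop) (localizationHom 𝕂 S a)).symm

/-- The localisation map `A → A_S` as a homomorphism of bimodules. -/
def localizationBimodMap : regularBimod 𝕂 A ⟶ localizedBimod 𝕂 S :=
  ModuleCat.ofHom (X := regularBimod 𝕂 A) (Y := localizedBimod 𝕂 S)
    { localizationAddHom 𝕂 S with map_smul' := localizationAddHom_smul 𝕂 S }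

/-- The complex `K(A;S) = (⋯ → 0 → A → A_S → 0 → ⋯)` of bimodules, with `A` in degree `0` and `A_S`
in degree `1`. -/
def localizationComplex : CochainComplex (BimodCat 𝕂 A) ℤ :=
  HomologicalComplex.double (localizationBimodMap 𝕂 S)
    (show (ComplexShape.up ℤ).Rel 0 1 from rfl)

/-- The morphism of complexes `e : K(A;S) ⟶ A` which is the identity of `A` in degree `0`. -/
def localizationComplexToRegular : localizationComplex 𝕂 S ⟶ regularComplex 𝕂 A :=
  HomologicalComplex.mkHomToSingle
    (HomologicalComplex.doubleXIso₀ (localizationBimodMap 𝕂 S) _).hom (fun i hi => by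
      simp only [ComplexShape.up_Rel] at hi
      exact (congrArg (· ≫ _) (HomologicalComplex.double_d_eq_zero₀ _ _ _ _ (by omega))).trans zero_comp)

end LocalizationComplex

section DerivedFunctors

variable {A : Type u} [Ring A] [HasDerivedCategory.{w} (ModuleCat.{u} A)]

/-- A total right derived functor `(RF, η)`, from the unbounded derived category `D(A)` to itself, of
the functor induced on complexes by an additive functor `F` between modules: `η : Q F ⟶ RF Q` is
universal, where `Q` is the functor from complexes to `D(A)`. -/
structure RightDerived (F : ModuleCat.{u} A ⥤ ModuleCat.{u} A) [F.Additive] where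
  functor : DerivedCategory (ModuleCat.{u} A) ⥤ DerivedCategory (ModuleCat.{u} A)
  unit : F.mapHomologicalComplex (ComplexShape.up ℤ) ⋙ DerivedCategory.Q ⟶
    DerivedCategory.Q ⋙ functor
  isRightDerived : functor.IsRightDerivedFunctor unit
    (HomologicalComplex.quasiIso (ModuleCat.{u} A) (ComplexShape.up ℤ))

/-- A total left derived functor `(LG, ε)` from `D(A)` to itself of an endofunctor `G` of the category
of complexes: `ε : LG Q ⟶ Q G` is universal. -/
structure LeftDerived
    (G : CochainComplex (ModuleCat.{u} A) ℤ ⥤ CochainComplex (ModuleCat.{u} A) ℤ) where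
  functor : DerivedCategory (ModuleCat.{u} A) ⥤ DerivedCategory (ModuleCat.{u} A)
  counit : DerivedCategory.Q ⋙ functor ⟶ G ⋙ DerivedCategory.Q
  isLeftDerived : functor.IsLeftDerivedFunctor counit
    (HomologicalComplex.quasiIso (ModuleCat.{u} A) (ComplexShape.up ℤ))

attribute [instance] RightDerived.isRightDerived LeftDerived.isLeftDerived

/-- The morphism `σ^R : RΓ_T ⟶ id` induced by `σ : Γ_T ⟶ id`, through the universal property of the
derived functor. -/
def derivedTorsionInclusion (T : ObjectProperty (ModuleCat.{u} A)) [IsTorsionClass T]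
    (RΓ : RightDerived (torsionFunctor T)) :
    RΓ.functor ⟶ 𝟭 (DerivedCategory (ModuleCat.{u} A)) :=
  RΓ.functor.rightDerivedDesc RΓ.unit
    (HomologicalComplex.quasiIso (ModuleCat.{u} A) (ComplexShape.up ℤ)) (𝟭 _)
    (Functor.whiskerRight
        (NatTrans.mapHomologicalComplex (torsionInclusion T) (ComplexShape.up ℤ) ≫
          (Functor.mapHomologicalComplexIdIso (ModuleCat.{u} A) (ComplexShape.up ℤ)).hom)
        DerivedCategory.Q ≫
      (Functor.leftUnitor _).hom ≫ (Functor.rightUnitor _).inv)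

variable {𝕂 : Type v} [CommRing 𝕂] [Algebra 𝕂 A]

/-- A derived tensor product functor `K ⊗^L_A (-)` on `D(A)`, for a complex `K` of bimodules. -/
abbrev DerivedTensor (K : CochainComplex (BimodCat 𝕂 A) ℤ) :=
  LeftDerived.{w} (complexTensor K)

/-- The identity functor of `D(A)` is the derived functor of the identity functor on complexes. -/
instance identity_isLeftDerived :
    (𝟭 (DerivedCategory (ModuleCat.{u} A))).IsLeftDerivedFunctor
      (DerivedCategory.Q (C := ModuleCat.{u} A)).rightUnitor.hom
      (HomologicalComplex.quasiIso (ModuleCat.{u} A) (ComplexShape.up ℤ)) :=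
  Functor.isLeftDerivedFunctor_of_inverts _ _ _

/-- The morphism `f ⊗^L id : K ⊗^L_A M ⟶ A ⊗^L_A M ≅ M`, natural in `M ∈ D(A)`, induced by a morphism
of complexes of bimodules `f : K ⟶ A`. -/
def derivedTensorToId {K : CochainComplex (BimodCat 𝕂 A) ℤ} (f : K ⟶ regularComplex 𝕂 A)
    (KL : DerivedTensor.{w} K) : KL.functor ⟶ 𝟭 (DerivedCategory (ModuleCat.{u} A)) :=
  Functor.leftDerivedNatTrans KL.functor (𝟭 _) KL.counit
    (DerivedCategory.Q (C := ModuleCat.{u} A)).rightUnitor.hom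
    (HomologicalComplex.quasiIso (ModuleCat.{u} A) (ComplexShape.up ℤ))
    (Functor.whiskerRight (complexTensorMap f ≫ complexTensorUnit 𝕂 A) DerivedCategory.Q ≫
      (Functor.leftUnitor _).hom)

variable (𝕂) in
/-- There is an isomorphism of functors `ν : RΓ_S ≅ K(A;S) ⊗^L_A (-)` on `D(A)` compatible with the
canonical maps to the identity functor, i.e. `(e ⊗^L id) ∘ ν = σ^R`. Derived functors are unique up to
unique isomorphism, so it does not matter which models of them are used. -/
def DerivedTorsionIsTensor (S : Submonoid A) [OreLocalization.OreSet S] : Prop :=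
  ∃ (RΓ : RightDerived.{w} (oreTorsionFunctor S))
    (KL : DerivedTensor.{w} (localizationComplex 𝕂 S))
    (ν : RΓ.functor ⟶ KL.functor),
    ν ≫ derivedTensorToId (localizationComplexToRegular 𝕂 S) KL =
      derivedTorsionInclusion (oreTorsionClass S) RΓ ∧ IsIso ν

end DerivedFunctors

end OreTorsion

end

/-! Everything turns on condition (iii). For a module `M`, surjectivity of `M → M_S` means that
elements of `M` can be divided by elements of `S` up to `S`-torsion.

Underived conditions. `R¹Γ_S(M) = 0` says that torsion lifts along every quotient map with kernel
`M` (`LiftsTorsion`). If `R¹Γ_S(M) = 0` and `R²Γ_S(Γ_S M) = 0`, the long exact sequence gives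
`R¹Γ_S(M/Γ_S M) = 0`. Lifting torsion along the embedding of `M/Γ_S M` in `M_S`, whose cokernel is
torsion, then shows that `M → M_S` is onto (`surjective_toLocalization_of_isZero`). This yields (i)
→ (iii) and (v) → (ii). Conversely, dividing up to torsion inside an injective resolution kills
`RⁿΓ_S` for `n ≥ 2` (`isZero_rightDerived_of_surjective`). As `R¹Γ_S` always vanishes on torsion
modules, (iii) implies both (i) and (v).

(iii) → (iv). The complex `K(A;S) ⊗ M` is the homotopy fiber of `M → A_S ⊗ M`. Since `A_S ⊗ (-)` is
exact, `K(A;S) ⊗ (-)` preserves quasi-isomorphisms and needs no resolution. If every term of `M`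
surjects onto its localisation, that fiber is quasi-isomorphic to `Γ_S M`. The modules with
surjective localisation map are closed under quotients, so under (iii) every unbounded complex has a
functorial resolution by such modules, built from one embedding into injectives and its cokernel.
Hence `K(A;S) ⊗ (-)` has the universal property of `RΓ_S`.

(iv) → (iii). For `E` injective, `H¹(K(A;S) ⊗ E)` is the cokernel of `E → E_S`, so it suffices that
`H¹(RΓ_S E) = 0`. Only the universal property of `RΓ_S` is available for this;
`isZero_homology_rightDerived_obj` extracts the vanishing from a natural transformation from the
identity of `D(A)` to injective modules in degree zero, which splits at `E`. -/

noncomputable section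

namespace OreTorsion

/-! ### Lifting torsion elements, and the cohomology of `Γ_S` in terms of elements. -/

section TorsionLifting

variable {A : Type u} [Ring A] (S : Submonoid A)

/-- Torsion elements can be lifted along every quotient map with kernel `M`. -/
def LiftsTorsion (M : ModuleCat.{u} A) : Prop :=
  ∀ (Y : ModuleCat.{u} A) (f : M →ₗ[A] Y), Function.Injective f → ∀ (y : Y), ∀ s ∈ S,
    s • y ∈ LinearMap.range f → ∃ m, ∃ t ∈ S, t • (y - f m) = 0

lemma torsion_of_torsion_smul {M : Type*} [AddCommGroup M] [Module A M] {x : M} {s : A}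
    (hs : s ∈ S) (hx : ∃ t ∈ S, t • s • x = 0) : ∃ t ∈ S, t • x = 0 := by
  obtain ⟨t, ht, h⟩ := hx
  exact ⟨t * s, S.mul_mem ht hs, by rw [mul_smul, h]⟩

lemma torsion_map {M N : Type*} [AddCommGroup M] [Module A M] [AddCommGroup N] [Module A N]
    (f : M →ₗ[A] N) {x : M} (hx : ∃ s ∈ S, s • x = 0) : ∃ s ∈ S, s • f x = 0 := by
  obtain ⟨s, hs, h⟩ := hx
  exact ⟨s, hs, by rw [← map_smul, h, map_zero]⟩

/-- An extension of torsion by torsion is torsion, so `y` is itself torsion and `0` is a lift. This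
is why `R¹Γ_S` vanishes on torsion modules. -/
lemma liftsTorsion_of_torsion (M : ModuleCat.{u} A) (hM : oreTorsionClass S M) :
    LiftsTorsion S M := by
  rintro Y f - y s hs ⟨m, hm⟩
  refine ⟨0, ?_⟩
  rw [map_zero, sub_zero]
  exact torsion_of_torsion_smul S hs (hm ▸ torsion_map S f (hM m))

variable [OreLocalization.OreSet S]

lemma torsion_add {M : Type*} [AddCommGroup M] [Module A M] {x y : M}
    (hx : ∃ s ∈ S, s • x = 0) (hy : ∃ s ∈ S, s • y = 0) : ∃ s ∈ S, s • (x + y) = 0 :=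
  (annihilatedSubmodule S M).add_mem hx hy

/-- Membership in `Γ_S` is a condition on single elements, so exactness of `Γ_S(I)` can be tested
inside `I`. The vanishing results below are element chases based on this form. -/
lemma isZero_rightDerived_succ_iff {M : ModuleCat.{u} A} (I : InjectiveResolution M) (n : ℕ) :
    IsZero (((oreTorsionFunctor S).rightDerived (n + 1)).obj M) ↔
      ∀ x : I.cocomplex.X (n + 1), I.cocomplex.d (n + 1) (n + 2) x = 0 →
        (∃ s ∈ S, s • x = 0) →
        ∃ y : I.cocomplex.X n, (∃ s ∈ S, s • y = 0) ∧ I.cocomplex.d n (n + 1) y = x := by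
  rw [(I.isoRightDerivedObj (oreTorsionFunctor S) (n + 1)).isZero_iff]
  refine (HomologicalComplex.exactAt_iff_isZero_homology _ _).symm.trans ?_
  rw [HomologicalComplex.exactAt_iff' _ n (n + 1) (n + 2) (by simp) (by simp),
    ShortComplex.moduleCat_exact_iff]
  constructor
  · intro h x hx hs
    obtain ⟨y, hy⟩ := h (⟨x, (mem_torsionSubmodule_iff S _ x).2 hs⟩ :
      torsionSubmodule (oreTorsionClass S) (I.cocomplex.X (n + 1))) (Subtype.ext hx)
    refine ⟨(y : torsionSubmodule (oreTorsionClass S) (I.cocomplex.X n)).1,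
      (mem_torsionSubmodule_iff S _ _).1 y.2, ?_⟩
    exact congrArg Subtype.val hy
  · intro h x hx
    obtain ⟨y, hs, hy⟩ := h (x : torsionSubmodule (oreTorsionClass S) (I.cocomplex.X (n + 1))).1
      (congrArg Subtype.val hx) ((mem_torsionSubmodule_iff S _ _).1 x.2)
    exact ⟨(⟨y, (mem_torsionSubmodule_iff S _ y).2 hs⟩ :
      torsionSubmodule (oreTorsionClass S) (I.cocomplex.X n)), Subtype.ext hy⟩

end TorsionLifting

/-! ### Injective resolutions in terms of elements. -/

section Resolutions

variable {A : Type u} [Ring A] {M : ModuleCat.{u} A} (I : InjectiveResolution M)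

/-- The inclusion of `M` into the first term of an injective resolution. -/
def resolutionInclusion : M →ₗ[A] I.cocomplex.X 0 := (I.ι.f 0).hom

lemma resolutionInclusion_injective : Function.Injective (resolutionInclusion I) :=
  (ModuleCat.mono_iff_injective (I.ι.f 0)).1 inferInstance

lemma d_resolutionInclusion (m : M) : I.cocomplex.d 0 1 (resolutionInclusion I m) = 0 :=
  congrArg (fun f => f.hom m) I.ι_f_zero_comp_complex_d

lemma exists_resolutionInclusion_eq (x : I.cocomplex.X 0) (hx : I.cocomplex.d 0 1 x = 0) :
    ∃ m, resolutionInclusion I m = x :=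
  (ShortComplex.moduleCat_exact_iff _).1 I.exact₀ x hx

lemma exists_d_eq (n : ℕ) (x : I.cocomplex.X (n + 1))
    (hx : I.cocomplex.d (n + 1) (n + 2) x = 0) : ∃ y, I.cocomplex.d n (n + 1) y = x :=
  (ShortComplex.moduleCat_exact_iff _).1 (I.exact_succ n) x hx

lemma exists_linearMap_extension {E X Y : Type u} [AddCommGroup E] [Module A E] [AddCommGroup X]
    [Module A X] [AddCommGroup Y] [Module A Y] (hE : Injective (ModuleCat.of A E))
    (f : X →ₗ[A] Y) (hf : Function.Injective f) (g : X →ₗ[A] E) :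
    ∃ h : Y →ₗ[A] E, ∀ x, h (f x) = g x := by
  have : Mono (ModuleCat.ofHom f) := (ModuleCat.mono_iff_injective _).2 hf
  have hh := Injective.comp_factorThru (ModuleCat.ofHom g) (ModuleCat.ofHom f)
  exact ⟨(Injective.factorThru (ModuleCat.ofHom g) (ModuleCat.ofHom f)).hom,
    fun x => congrArg (fun k => k.hom x) hh⟩

end Resolutions

/-! ### The implications between (i), (ii), (iii) and (v). -/

section Criteria

variable {A : Type u} [Ring A] (S : Submonoid A) [OreLocalization.OreSet S]

/-- `R¹Γ_S(M)` is the obstruction to lifting torsion along `I⁰ → I⁰/M`. An arbitrary embedding `M →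
Y` is compared with this one by extending `M → I⁰` to `Y`. -/
lemma isZero_rightDerived_one_iff (M : ModuleCat.{u} A) :
    IsZero (((oreTorsionFunctor S).rightDerived 1).obj M) ↔ LiftsTorsion S M := by
  let I := InjectiveResolution.of M
  rw [isZero_rightDerived_succ_iff S I 0]
  constructor
  · intro h Y f hf y s hs hy
    obtain ⟨g, hg⟩ := exists_linearMap_extension (I.injective 0) f hf (resolutionInclusion I)
    obtain ⟨m₀, hm₀⟩ := hy
    obtain ⟨x, hx, hxy⟩ := h (I.cocomplex.d 0 1 (g y))
      (congrArg (fun k => k.hom (g y)) (I.cocomplex.d_comp_d 0 1 2))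
      ⟨s, hs, by rw [← map_smul, ← map_smul, ← hm₀, hg, d_resolutionInclusion]⟩
    obtain ⟨m, hm⟩ := exists_resolutionInclusion_eq I (g y - x) (by rw [map_sub, hxy, sub_self])
    refine ⟨m, ?_⟩
    have hgx : g (y - f m) = x := by rw [map_sub, hg, hm]; abel
    obtain ⟨t, ht, htx⟩ := hx
    -- The extension `g` is known to be injective only on the image of `M`, so torsion of `g (y - f
    -- m)` does not pass directly to `y - f m`. The Ore condition gives a common left multiple of
    -- `t`, which kills `g (y - f m)`, and of `s`, which moves `y - f m` into the image of `f`.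
    have hore := OreLocalization.ore_eq t (⟨s, hs⟩ : S)
    refine ⟨OreLocalization.oreDenom t (⟨s, hs⟩ : S) * t,
      S.mul_mem (SetLike.coe_mem _) ht, ?_⟩
    have hmem : (OreLocalization.oreDenom t (⟨s, hs⟩ : S) * t : A) • (y - f m) =
        f (OreLocalization.oreNum t (⟨s, hs⟩ : S) • (m₀ - s • m)) := by
      rw [hore, mul_smul, smul_sub s y, ← hm₀]
      simp
    rw [hmem]
    have hz : resolutionInclusion I
        (OreLocalization.oreNum t (⟨s, hs⟩ : S) • (m₀ - s • m)) = 0 := by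
      rw [← hg, ← hmem, map_smul, hgx, mul_smul, htx, smul_zero]
    rw [resolutionInclusion_injective I (hz.trans (map_zero _).symm), map_zero]
  · intro h x hx ⟨s, hs, hsx⟩
    obtain ⟨y, hy⟩ := exists_d_eq I 0 x hx
    obtain ⟨m, hm⟩ := exists_resolutionInclusion_eq I (s • y) (by rw [map_smul, hy, hsx])
    obtain ⟨m', t, ht, h'⟩ := h _ (resolutionInclusion I) (resolutionInclusion_injective I) y s hs
      ⟨m, hm⟩
    exact ⟨y - resolutionInclusion I m', ⟨t, ht, h'⟩, by
      rw [map_sub, d_resolutionInclusion, sub_zero, hy]⟩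

/-- This is exactness of `R¹Γ_S(M) → R¹Γ_S(M/N) → R²Γ_S(N)`, chased through an injective resolution
of `N`. -/
lemma LiftsTorsion.quotient {N : ModuleCat.{u} A}
    (hN : IsZero (((oreTorsionFunctor S).rightDerived 2).obj N))
    (M : ModuleCat.{u} A) (hM : LiftsTorsion S M) (f : N →ₗ[A] M) (hf : Function.Injective f) :
    LiftsTorsion S (ModuleCat.of A (M ⧸ LinearMap.range f)) := by
  let I := InjectiveResolution.of N
  rw [isZero_rightDerived_succ_iff S I 1] at hN
  obtain ⟨g, hg⟩ := exists_linearMap_extension (I.injective 0) f hf (resolutionInclusion I)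
  intro Y j hj y s hs hy
  let q : M →ₗ[A] M ⧸ LinearMap.range f := (LinearMap.range f).mkQ
  let dg : M ⧸ LinearMap.range f →ₗ[A] I.cocomplex.X 1 :=
    (LinearMap.range f).liftQ ((I.cocomplex.d 0 1).hom ∘ₗ g) (by
      rintro _ ⟨n, rfl⟩
      rw [LinearMap.mem_ker, LinearMap.comp_apply, hg]
      exact d_resolutionInclusion I n)
  have hdg (m : M) : dg (q m) = I.cocomplex.d 0 1 (g m) := rfl
  obtain ⟨k, hk⟩ := exists_linearMap_extension (I.injective 1) j hj dg
  obtain ⟨m₀, hm₀⟩ := hy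
  obtain ⟨m, rfl⟩ : ∃ m, q m = m₀ := Submodule.mkQ_surjective _ m₀
  have dd (n : ℕ) (x : I.cocomplex.X n) :
      I.cocomplex.d (n + 1) (n + 2) (I.cocomplex.d n (n + 1) x) = 0 :=
    congrArg (fun k => k.hom x) (I.cocomplex.d_comp_d n (n + 1) (n + 2))
  have hsk : s • k y = I.cocomplex.d 0 1 (g m) := by rw [← map_smul, ← hm₀, hk, hdg]
  obtain ⟨x, ⟨t, ht, hx⟩, hxy⟩ := hN (I.cocomplex.d 1 2 (k y)) (dd 1 _)
    ⟨s, hs, by rw [← map_smul, hsk]; exact dd 0 _⟩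
  obtain ⟨w, hw⟩ := exists_d_eq I 0 (k y - x) (by rw [map_sub]; exact sub_eq_zero.2 hxy.symm)
  have hore := OreLocalization.ore_eq t (⟨s, hs⟩ : S)
  set a : A := (OreLocalization.oreDenom t (⟨s, hs⟩ : S) : A)
  set b : A := OreLocalization.oreNum t (⟨s, hs⟩ : S)
  have hu : a * t ∈ S := S.mul_mem (SetLike.coe_mem _) ht
  -- Multiplication by `a * t = b * s` removes the torsion correction `x` and replaces `s • k y` by
  -- `d (g m)`. The resulting cycle of degree zero comes from `N`.
  have hdw : I.cocomplex.d 0 1 ((a * t) • w - g (b • m)) = 0 := by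
    rw [map_sub, map_smul, hw, smul_sub, mul_smul a t x, hx, smul_zero, sub_zero, hore, mul_smul,
      map_smul, map_smul, ← hsk]
    exact sub_self _
  obtain ⟨n, hn⟩ := exists_resolutionInclusion_eq I _ hdw
  have hqf (n : N) : q (f n) = 0 :=
    (Submodule.Quotient.mk_eq_zero _).2 (LinearMap.mem_range_self f n)
  -- `M` need not embed in `Y`, but it embeds in `Y × I⁰`: the kernel of the first coordinate is
  -- `N`, on which `g` is injective. The first coordinate of the lift is the one wanted.
  obtain ⟨m', r, hr, h'⟩ := hM (ModuleCat.of A (Y × I.cocomplex.X 0)) ((j ∘ₗ q).prod g)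
    (by
      rw [← LinearMap.ker_eq_bot, LinearMap.ker_eq_bot']
      intro x hx
      obtain ⟨h₁, h₂⟩ := Prod.ext_iff.1 hx
      have h₃ : q x = 0 := hj (h₁.trans (map_zero j).symm)
      obtain ⟨n, rfl⟩ := (Submodule.Quotient.mk_eq_zero _).1 h₃
      have h₄ : resolutionInclusion I n = 0 := (hg n).symm.trans h₂
      rw [resolutionInclusion_injective I (h₄.trans (map_zero _).symm), map_zero])
    (y, w) (a * t) hu ⟨b • m + f n, Prod.ext (by
        change j (q (b • m + f n)) = (a * t) • y
        rw [map_add, hqf, add_zero, map_smul, map_smul, hm₀, hore, mul_smul]) (by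
        change g (b • m + f n) = (a * t) • w
        rw [map_add, hg, hn]; abel)⟩
  exact ⟨q m', r, hr, congrArg Prod.fst h'⟩

lemma toLocalization_eq_iff {M : ModuleCat.{u} A} (m m' : M) :
    toLocalization S M m = toLocalization S M m' ↔ ∃ s ∈ S, s • (m - m') = 0 := by
  rw [toLocalization, toLocalization, OreLocalization.oreDiv_eq_iff]
  constructor
  · rintro ⟨u, v, h, h'⟩
    simp only [Submonoid.coe_one, mul_one] at h'
    refine ⟨u, u.2, ?_⟩
    rw [← h'] at h
    rw [smul_sub, sub_eq_zero]
    exact h.symm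
  · rintro ⟨s, hs, h⟩
    refine ⟨⟨s, hs⟩, s, ?_, rfl⟩
    rw [smul_sub, sub_eq_zero] at h
    exact h.symm

/-- In this form, divisibility by `S` up to torsion, the condition visibly passes to quotients and
finite products. -/
lemma toLocalization_surjective_iff (M : ModuleCat.{u} A) :
    Function.Surjective (toLocalization S M) ↔
      ∀ (m : M), ∀ s ∈ S, ∃ m' : M, ∃ t ∈ S, t • (s • m' - m) = 0 := by
  have key (m m' : M) (s : S) : toLocalization S M m' = OreLocalization.oreDiv m s ↔
      ∃ t ∈ S, t • ((s : A) • m' - m) = 0 := by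
    rw [toLocalization, OreLocalization.oreDiv_eq_iff]
    constructor
    · rintro ⟨u, v, h, h'⟩
      refine ⟨u, u.2, ?_⟩
      rw [smul_sub, ← mul_smul, h', sub_eq_zero]
      rw [Submonoid.coe_one, mul_one]
      exact h.symm
    · rintro ⟨t, ht, h⟩
      refine ⟨⟨t, ht⟩, t * s, ?_, by simp⟩
      rw [smul_sub, sub_eq_zero] at h
      rw [mul_smul]
      exact h.symm
  constructor
  · intro h m s hs
    obtain ⟨m', hm'⟩ := h (OreLocalization.oreDiv m ⟨s, hs⟩)
    exact ⟨m', (key _ _ _).1 hm'⟩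
  · intro h x
    induction x with | _ m s
    obtain ⟨m', hm'⟩ := h m s s.2
    exact ⟨m', (key _ _ _).2 hm'⟩

/-- `M/Γ_S(M)` embeds in `M_S`, and `s` moves the fraction `s⁻¹m` into its image. Lifting torsion
gives an `m'` whose image differs from the fraction by torsion, and `M_S` has none because `S` acts
invertibly. -/
lemma surjective_toLocalization_of_liftsTorsion (M : ModuleCat.{u} A)
    (h : LiftsTorsion S (ModuleCat.of A (M ⧸ LinearMap.range
      (torsionSubmodule (oreTorsionClass S) M).subtype))) :
    Function.Surjective (toLocalization S M) := by
  let j₀ : M →ₗ[A] OreLocalization S M :=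
    { toFun := toLocalization S M
      map_add' := fun x y => (OreLocalization.add_oreDiv).symm
      map_smul' := fun a x => (OreLocalization.smul_oreDiv_one a x).symm }
  have hker (m : M) : j₀ m = 0 ↔ ∃ s ∈ S, s • m = 0 := by
    have := toLocalization_eq_iff S m 0
    rw [sub_zero] at this
    rw [← this]
    exact (map_zero j₀).symm ▸ Iff.rfl
  let T := LinearMap.range (torsionSubmodule (oreTorsionClass S) M).subtype
  have hT (m : M) : m ∈ T ↔ ∃ s ∈ S, s • m = 0 := by
    rw [← mem_torsionSubmodule_iff, ← Submodule.range_subtype (torsionSubmodule _ M)]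
  let j : M ⧸ T →ₗ[A] OreLocalization S M := T.liftQ j₀ fun m hm => (hker m).2 ((hT m).1 hm)
  have hj : Function.Injective j := by
    rw [← LinearMap.ker_eq_bot, LinearMap.ker_eq_bot']
    intro x hx
    obtain ⟨m, rfl⟩ := Submodule.mkQ_surjective _ x
    exact (Submodule.Quotient.mk_eq_zero _).2 ((hT m).2 ((hker m).1 hx))
  intro x
  induction x with | _ m s
  obtain ⟨m', t, ht, h'⟩ := h (ModuleCat.of A (OreLocalization S M)) j hj
    (OreLocalization.oreDiv m s) s s.2 ⟨T.mkQ m, by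
      change OreLocalization.oreDiv m 1 = (s : A) • OreLocalization.oreDiv m s
      rw [← OreLocalization.oreDiv_one_smul, OreLocalization.smul_cancel]⟩
  obtain ⟨m', rfl⟩ := Submodule.mkQ_surjective _ m'
  refine ⟨m', ?_⟩
  have h'' : t • (OreLocalization.oreDiv m s - j₀ m') = (0 : OreLocalization S M) := h'
  have hcancel (z : OreLocalization S M) (hz : t • z = 0) : z = 0 := by
    rw [← OreLocalization.oreDiv_one_smul] at hz
    have := congrArg (fun z => OreLocalization.oreDiv (1 : A) (⟨t, ht⟩ : S) • z) hz
    simp only [smul_zero, ← mul_smul] at this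
    have hinv : OreLocalization.oreDiv (1 : A) (⟨t, ht⟩ : S) * OreLocalization.oreDiv t 1 = 1 :=
      OreLocalization.mul_inv (1 : S) ⟨t, ht⟩
    rwa [hinv, one_smul] at this
  exact (sub_eq_zero.1 (hcancel _ h'')).symm

lemma surjective_toLocalization_of_isZero (M : ModuleCat.{u} A)
    (h₁ : IsZero (((oreTorsionFunctor S).rightDerived 1).obj M))
    (h₂ : IsZero (((oreTorsionFunctor S).rightDerived 2).obj ((oreTorsionFunctor S).obj M))) :
    Function.Surjective (toLocalization S M) :=
  surjective_toLocalization_of_liftsTorsion S M <|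
    LiftsTorsion.quotient S h₂ M ((isZero_rightDerived_one_iff S M).1 h₁) _
      (Submodule.injective_subtype _)

/-- From degree 2 on, two earlier terms of the resolution are available. A torsion cycle is `x = d
y` with `s • y = d z`; dividing `z` by `s` up to torsion gives `z'`, and `y - d z'` is a torsion
preimage of `x`. -/
lemma isZero_rightDerived_of_surjective
    (h : ∀ E : ModuleCat.{u} A, Injective E → Function.Surjective (toLocalization S E))
    (M : ModuleCat.{u} A) (n : ℕ) (hn : 2 ≤ n) :
    IsZero (((oreTorsionFunctor S).rightDerived n).obj M) := by
  obtain ⟨n, rfl⟩ := Nat.exists_eq_add_of_le' hn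
  let I := InjectiveResolution.of M
  refine (isZero_rightDerived_succ_iff S I (n + 1)).2 ?_
  rintro x hx ⟨s, hs, hsx⟩
  obtain ⟨y, rfl⟩ := exists_d_eq I (n + 1) x hx
  obtain ⟨z, hz⟩ := exists_d_eq I n (s • y) (by rw [map_smul]; exact hsx)
  obtain ⟨z', t, ht, h'⟩ := (toLocalization_surjective_iff S _).1 (h _ (I.injective n)) z s hs
  refine ⟨y - I.cocomplex.d n (n + 1) z', torsion_of_torsion_smul S hs ⟨t, ht, ?_⟩, ?_⟩
  · have := congrArg (I.cocomplex.d n (n + 1)) h'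
    rw [map_smul, map_sub, map_smul, hz, map_zero] at this
    rw [smul_sub s, ← neg_sub, smul_neg, this, neg_zero]
  · rw [map_sub]
    exact (congrArg (_ - ·) (congrArg (fun k => k.hom z')
      (I.cocomplex.d_comp_d n (n + 1) (n + 2)))).trans (sub_zero _)

lemma rightCohomologicalDimension_le_one_iff :
    rightCohomologicalDimension (oreTorsionFunctor S) ≤ 1 ↔
      ∀ (n : ℕ), 2 ≤ n → ∀ M, IsZero (((oreTorsionFunctor S).rightDerived n).obj M) := by
  rw [rightCohomologicalDimension, iSup₂_le_iff]
  constructor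
  · intro h n hn M
    by_contra hM
    have := h n fun hz => hM (hz.obj M)
    have : n ≤ 1 := by exact_mod_cast this
    omega
  · intro h n hn
    by_contra hn'
    refine hn (Functor.isZero _ fun M => h n ?_ M)
    by_contra hlt
    exact hn' (by exact_mod_cast (by omega : n ≤ 1))

lemma surjective_toLocalization_of_isWeaklyStable (h : IsWeaklyStable (oreTorsionClass S))
    (E : ModuleCat.{u} A) (hE : Injective E) : Function.Surjective (toLocalization S E) :=
  surjective_toLocalization_of_isZero S E
    ((oreTorsionFunctor S).isZero_rightDerived_obj_injective_succ 0 E) (h E hE 2 (by norm_num))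

lemma isWeaklyStable_of_surjective
    (h : ∀ E : ModuleCat.{u} A, Injective E → Function.Surjective (toLocalization S E)) :
    IsWeaklyStable (oreTorsionClass S) := by
  intro E hE n hn
  obtain rfl | hn := hn.eq_or_lt
  -- In degree 1 it is enough that `Γ_S(E)` is torsion.
  · refine (isZero_rightDerived_one_iff S _).2 (liftsTorsion_of_torsion S _ fun m => ?_)
    obtain ⟨s, hs, hm⟩ := (mem_torsionSubmodule_iff S E _).1
      (m : torsionSubmodule (oreTorsionClass S) E).2
    exact ⟨s, hs, Subtype.ext hm⟩
  · exact isZero_rightDerived_of_surjective S h _ n hn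

lemma isRightAcyclic_of_injective (E : ModuleCat.{u} A) (hE : Injective E) :
    IsRightAcyclic (oreTorsionFunctor S) E := by
  intro n hn
  obtain ⟨n, rfl⟩ := Nat.exists_eq_add_of_le' hn
  exact (oreTorsionFunctor S).isZero_rightDerived_obj_injective_succ n E

end Criteria

/-! ### Calculus of pure tensors over `A`, and `A ⊗_A M ≅ M`. -/

section TensorLemmas

variable {𝕂 : Type v} [CommRing 𝕂] {A : Type u} [Ring A] [Algebra 𝕂 A]

lemma tmul_add {N : BimodCat 𝕂 A} {M : ModuleCat.{u} A} (n : N) (m m' : M) :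
    tmul n (m + m') = tmul n m + tmul n m' :=
  (congrArg (balancing N M).mkQ (TensorProduct.tmul_add (R := ℤ) (M := (leftModule 𝕂).obj N)
    n m m')).trans (map_add _ _ _)

lemma add_tmul {N : BimodCat 𝕂 A} {M : ModuleCat.{u} A} (n n' : N) (m : M) :
    tmul (n + n') m = tmul n m + tmul n' m :=
  (congrArg (balancing N M).mkQ (TensorProduct.add_tmul (R := ℤ) (M := (leftModule 𝕂).obj N)
    n n' m)).trans (map_add _ _ _)

lemma rightMul_tmul {N : BimodCat 𝕂 A} {M : ModuleCat.{u} A} (n : N) (a : A) (m : M) :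
    tmul (rightMul N n a) m = tmul n (a • m) := by
  have h : (balancing N M).mkQ (intTmul N M (rightMul N n a) m - intTmul N M n (a • m)) = 0 :=
    (Submodule.Quotient.mk_eq_zero _).2 (Submodule.subset_span ⟨n, a, m, rfl⟩)
  rw [map_sub, sub_eq_zero] at h
  exact h

lemma tmul_zero {N : BimodCat 𝕂 A} {M : ModuleCat.{u} A} (n : N) :
    tmul n (0 : M) = 0 := by
  have := tmul_add n (0 : M) 0
  rwa [add_zero, left_eq_add] at this

lemma tmul_neg {N : BimodCat 𝕂 A} {M : ModuleCat.{u} A} (n : N) (m : M) :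
    tmul n (-m) = -tmul n m := by
  rw [eq_neg_iff_add_eq_zero, ← tmul_add, neg_add_cancel, tmul_zero]

lemma tmul_sub {N : BimodCat 𝕂 A} {M : ModuleCat.{u} A} (n : N) (m m' : M) :
    tmul n (m - m') = tmul n m - tmul n m' := by
  rw [sub_eq_add_neg, tmul_add, tmul_neg, ← sub_eq_add_neg]

lemma smul_tmul {N : BimodCat 𝕂 A} {M : ModuleCat.{u} A} (a : A) (n : N) (m : M) :
    a • tmul n m = tmul ((a ⊗ₜ[𝕂] (1 : Aᵐᵒᵖ)) • n) m := rfl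

lemma tensor_induction {N : BimodCat 𝕂 A} {M : ModuleCat.{u} A} (p : tensorObj N M → Prop)
    (h₀ : p 0) (h₁ : ∀ n m, p (tmul n m)) (h₂ : ∀ x y, p x → p y → p (x + y))
    (x : tensorObj N M) : p x := by
  obtain ⟨x, rfl⟩ := Submodule.mkQ_surjective _ x
  induction x using TensorProduct.induction_on with
  | zero => exact (map_zero (balancing N M).mkQ).symm ▸ h₀
  | tmul n m => exact h₁ n m
  | add x y hx hy => exact (map_add (balancing N M).mkQ x y).symm ▸ h₂ _ _ hx hy

instance (N : BimodCat 𝕂 A) : ((tensorBifunctor 𝕂 A).obj N).Additive where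
  map_add := tensor_hom_ext fun n _ => tmul_add n _ _

lemma rightMul_regularBimod (x a : A) :
    rightMul (regularBimod 𝕂 A) (show regularBimod 𝕂 A from x) a = (x * a : A) := by
  refine (regularBimod_smul (𝕂 := 𝕂) 1 a x).trans ?_
  have h (p q : A) : 1 * p * q = p * q := by rw [one_mul]
  exact h x a

/-- The element `1` of the regular bimodule. -/
def regularOne : regularBimod 𝕂 A := (1 : A)

lemma rightMul_regularOne (a : regularBimod 𝕂 A) :
    rightMul (regularBimod 𝕂 A) regularOne (show A from a) = a := by
  refine (rightMul_regularBimod (𝕂 := 𝕂) 1 (show A from a)).trans ?_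
  have h (p : A) : 1 * p = p := one_mul p
  exact h a

instance isIso_tensorUnit_app (M : ModuleCat.{u} A) : IsIso ((tensorUnit 𝕂 A).app M) := by
  rw [ConcreteCategory.isIso_iff_bijective]
  have hunit (m : M) : (tensorUnit 𝕂 A).app M (tmul regularOne m) = m :=
    (tensorUnit_tmul M 1 m).trans (one_smul A m)
  have hsurj (x : tensorObj (regularBimod 𝕂 A) M) : ∃ m : M, x = tmul regularOne m := by
    induction x using tensor_induction with
    | h₀ => exact ⟨0, (tmul_zero _).symm⟩
    | h₁ n m => exact ⟨(show A from n) • m, by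
        rw [← rightMul_tmul, rightMul_regularOne]⟩
    | h₂ x y hx hy =>
      obtain ⟨m, rfl⟩ := hx
      obtain ⟨m', rfl⟩ := hy
      exact ⟨m + m', (tmul_add _ _ _).symm⟩
  refine ⟨fun x y h => ?_, fun m => ⟨tmul regularOne m, hunit m⟩⟩
  obtain ⟨m, rfl⟩ := hsurj x
  obtain ⟨m', rfl⟩ := hsurj y
  rw [hunit, hunit] at h
  rw [h]

instance : IsIso (tensorUnit 𝕂 A) := NatIso.isIso_of_isIso_app _

end TensorLemmas

/-! ### The module `A_S ⊗_A M` as a module of left fractions. -/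

section Localization

variable (𝕂 : Type v) [CommRing 𝕂] {A : Type u} [Ring A] [Algebra 𝕂 A]
  (S : Submonoid A) [OreLocalization.OreSet S]

/-- The localisation functor `M ↦ A_S ⊗_A M`. -/
abbrev localizationFunctor : ModuleCat.{u} A ⥤ ModuleCat.{u} A :=
  (tensorBifunctor 𝕂 A).obj (localizedBimod 𝕂 S)

/-- An element of the ring `A_S`, as an element of the bimodule `A_S`. -/
def toLocalizedBimod (x : OreLocalization S A) : localizedBimod 𝕂 S := x

lemma toLocalizedBimod_surjective : Function.Surjective (toLocalizedBimod 𝕂 S) := fun x => ⟨x, rfl⟩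

lemma localizedBimod_smul (a b : A) (x : OreLocalization S A) :
    (a ⊗ₜ[𝕂] MulOpposite.op b) • toLocalizedBimod 𝕂 S x =
      toLocalizedBimod 𝕂 S (localizationHom 𝕂 S a * x * localizationHom 𝕂 S b) :=
  regularBimod_smul (𝕂 := 𝕂) (localizationHom 𝕂 S a) (localizationHom 𝕂 S b) x

lemma rightMul_toLocalizedBimod (x : OreLocalization S A) (a : A) :
    rightMul _ (toLocalizedBimod 𝕂 S x) a =
      toLocalizedBimod 𝕂 S (x * OreLocalization.oreDiv a 1) := by
  refine (localizedBimod_smul 𝕂 S 1 a x).trans ?_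
  rw [map_one, one_mul]
  rfl

/-- The fraction `s⁻¹ m = s⁻¹ ⊗ m` in `A_S ⊗_A M`. -/
def fraction {M : ModuleCat.{u} A} (m : M) (s : S) : (localizationFunctor 𝕂 S).obj M :=
  tmul (toLocalizedBimod 𝕂 S (OreLocalization.oreDiv 1 s)) m

variable {𝕂 S}

lemma fraction_add {M : ModuleCat.{u} A} (m m' : M) (s : S) :
    fraction 𝕂 S (m + m') s = fraction 𝕂 S m s + fraction 𝕂 S m' s := tmul_add _ _ _

lemma fraction_sub {M : ModuleCat.{u} A} (m m' : M) (s : S) :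
    fraction 𝕂 S (m - m') s = fraction 𝕂 S m s - fraction 𝕂 S m' s := tmul_sub _ _ _

lemma map_fraction {M M' : ModuleCat.{u} A} (f : M ⟶ M') (m : M) (s : S) :
    (localizationFunctor 𝕂 S).map f (fraction 𝕂 S m s) = fraction 𝕂 S (f m) s := rfl

lemma oreDiv_tmul {M : ModuleCat.{u} A} (a : A) (s : S) (m : M) :
    tmul (toLocalizedBimod 𝕂 S (OreLocalization.oreDiv a s)) m = fraction 𝕂 S (a • m) s := by
  rw [fraction, ← rightMul_tmul, rightMul_toLocalizedBimod, OreLocalization.mul_div_one, one_mul]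

/-- Only the product `a * s` has to lie in `S`, not `a`. Common denominators from the Ore condition
have exactly this form. -/
lemma fraction_smul {M : ModuleCat.{u} A} (a : A) (s u : S) (h : (u : A) = a * s) (m : M) :
    fraction 𝕂 S (a • m) u = fraction 𝕂 S m s := by
  have hu : u = ⟨a * s, h ▸ u.2⟩ := Subtype.ext h
  rw [← oreDiv_tmul, fraction,
    OreLocalization.expand (1 : A) s a (h ▸ u.2), smul_eq_mul, mul_one, ← hu]

lemma exists_eq_fraction {M : ModuleCat.{u} A} (x : (localizationFunctor 𝕂 S).obj M) :
    ∃ m s, x = fraction 𝕂 S m s := by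
  induction x using tensor_induction with
  | h₀ => exact ⟨0, 1, (tmul_zero _).symm⟩
  | h₁ n m =>
    obtain ⟨x, rfl⟩ := toLocalizedBimod_surjective 𝕂 S n
    induction x with | _ a s
    exact ⟨a • m, s, oreDiv_tmul a s m⟩
  | h₂ x y hx hy =>
    obtain ⟨m, s, rfl⟩ := hx
    obtain ⟨m', t, rfl⟩ := hy
    have hore := OreLocalization.ore_eq (s : A) t
    refine ⟨(OreLocalization.oreDenom (s : A) t : A) • m + OreLocalization.oreNum (s : A) t • m',
      OreLocalization.oreDenom (s : A) t * s, ?_⟩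
    rw [fraction_add, fraction_smul _ s _ rfl, fraction_smul _ t _ hore]
    rfl

/-- The comparison of `A_S ⊗_A M` with the Ore localisation of `M`. -/
def toOreLocalization (M : ModuleCat.{u} A) :
    (localizationFunctor 𝕂 S).obj M →ₗ[A] OreLocalization S M :=
  Submodule.liftQ _ (TensorProduct.AlgebraTensorModule.lift
    { toFun := fun x => ((DistribSMul.toAddMonoidHom (OreLocalization S M)
          (show OreLocalization S A from x)).comp
        { toFun := toLocalization S M
          map_zero' := OreLocalization.zero_oreDiv 1
          map_add' := fun x y => (OreLocalization.add_oreDiv).symm }).toIntLinearMap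
      map_add' := fun a b => by
        ext m
        exact add_smul (show OreLocalization S A from a) (show OreLocalization S A from b) _
      map_smul' := fun a b => by
        ext m
        have h₁ := congrArg (fun c : OreLocalization S A => c • toLocalization S M m)
          (localizedBimod_smul 𝕂 S a 1 b)
        refine h₁.trans ?_
        have h (p : A) (q : OreLocalization S A) (z : OreLocalization S M) :
            (localizationHom 𝕂 S p * q * localizationHom 𝕂 S 1) • z = p • q • z := by
          rw [map_one, mul_one, mul_smul]
          exact OreLocalization.oreDiv_one_smul p _
        exact h a b _ }) (by
    rw [balancing, Submodule.span_le]
    rintro _ ⟨n, a, m, rfl⟩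
    obtain ⟨x, rfl⟩ := toLocalizedBimod_surjective 𝕂 S n
    rw [rightMul_toLocalizedBimod]
    refine (map_sub _ _ _).trans (sub_eq_zero.2 ?_)
    change (x * OreLocalization.oreDiv a 1) • (OreLocalization.oreDiv m 1 : OreLocalization S M) =
      x • OreLocalization.oreDiv (a • m) 1
    rw [mul_smul, OreLocalization.smul_div_one])

lemma toOreLocalization_fraction {M : ModuleCat.{u} A} (m : M) (s : S) :
    toOreLocalization (𝕂 := 𝕂) M (fraction 𝕂 S m s) = OreLocalization.oreDiv m s := by
  have h : toOreLocalization (𝕂 := 𝕂) M (fraction 𝕂 S m s) =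
      OreLocalization.oreDiv (1 : A) s • (OreLocalization.oreDiv m 1 : OreLocalization S M) := rfl
  rw [h, OreLocalization.smul_div_one, one_smul]

/-- Non-vanishing is hard to see in a quotient of a tensor product. It is detected in the Ore
localisation, where equality of fractions is explicit. -/
lemma fraction_eq_zero_iff {M : ModuleCat.{u} A} (m : M) (s : S) :
    fraction 𝕂 S m s = 0 ↔ ∃ t ∈ S, t • m = 0 := by
  constructor
  · intro h
    have h' := congrArg (toOreLocalization (𝕂 := 𝕂) M) h
    rw [toOreLocalization_fraction, map_zero] at h'
    have h'' := congrArg (fun z => OreLocalization.oreDiv (s : A) (1 : S) • z) h'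
    simp only [smul_zero, OreLocalization.smul_cancel] at h''
    have := (toLocalization_eq_iff S m 0).1 (h''.trans (OreLocalization.zero_oreDiv 1).symm)
    rwa [sub_zero] at this
  · rintro ⟨t, ht, h⟩
    rw [← fraction_smul t s (⟨t, ht⟩ * s) rfl, h]
    exact tmul_zero _

lemma fraction_eq_iff {M : ModuleCat.{u} A} (m m' : M) (s : S) :
    fraction 𝕂 S m s = fraction 𝕂 S m' s ↔ ∃ t ∈ S, t • (m - m') = 0 := by
  rw [← fraction_eq_zero_iff (𝕂 := 𝕂) _ s, fraction_sub, sub_eq_zero]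

/-- Flatness of `A_S`: if `s⁻¹y` maps to zero, some `t ∈ S` kills the image of `y`. Then `t • y`
lifts to some `x`, and `(ts)⁻¹x` maps to `s⁻¹y`. -/
instance : (localizationFunctor 𝕂 S).PreservesHomology :=
  Functor.preservesHomology_of_map_exact _ fun E hE => by
    rw [ShortComplex.moduleCat_exact_iff] at hE ⊢
    intro y hy
    obtain ⟨y, s, rfl⟩ := exists_eq_fraction (𝕂 := 𝕂) (M := E.X₂) y
    obtain ⟨t, ht, h⟩ := (fraction_eq_zero_iff (𝕂 := 𝕂) (E.g y) s).1 hy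
    obtain ⟨x, hx⟩ := hE (t • y) (by rw [map_smul, h])
    refine ⟨fraction 𝕂 S x (⟨t, ht⟩ * s), ?_⟩
    refine (map_fraction E.f x _).trans ?_
    rw [hx, fraction_smul t s _ rfl]

lemma smul_fraction_one {M : ModuleCat.{u} A} (a : A) (m : M) :
    a • fraction 𝕂 S m 1 = fraction 𝕂 S (a • m) 1 := by
  rw [← oreDiv_tmul]
  refine (smul_tmul a _ m).trans
    (congrArg (fun x => tmul x m) ((localizedBimod_smul 𝕂 S a 1 _).trans ?_))
  rw [map_one, mul_one]
  refine congrArg (toLocalizedBimod 𝕂 S) ?_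
  rw [← OreLocalization.one_def, mul_one]
  rfl

variable (𝕂 S) in
/-- The localisation maps `M ⟶ A_S ⊗_A M`. -/
def localizationUnit : 𝟭 (ModuleCat.{u} A) ⟶ localizationFunctor 𝕂 S where
  app M := ModuleCat.ofHom
    { toFun := fun m => fraction 𝕂 S m 1
      map_add' := fun m m' => fraction_add m m' 1
      map_smul' := fun a m => (smul_fraction_one a m).symm }

lemma localizationUnit_app_eq_zero_iff {M : ModuleCat.{u} A} (m : M) :
    (localizationUnit 𝕂 S).app M m = 0 ↔ ∃ t ∈ S, t • m = 0 :=
  fraction_eq_zero_iff m 1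

lemma localizationUnit_app_surjective_iff (M : ModuleCat.{u} A) :
    Function.Surjective ((localizationUnit 𝕂 S).app M) ↔
      Function.Surjective (toLocalization S M) := by
  have key (m m' : M) (s : S) : (localizationUnit 𝕂 S).app M m' = fraction 𝕂 S m s ↔
      ∃ t ∈ S, t • ((s : A) • m' - m) = 0 := by
    rw [← fraction_eq_iff (𝕂 := 𝕂) _ _ s, fraction_smul (s : A) 1 s (mul_one _).symm]
    rfl
  rw [toLocalization_surjective_iff]
  constructor
  · intro h m s hs
    obtain ⟨m', hm'⟩ := h (fraction 𝕂 S m ⟨s, hs⟩)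
    exact ⟨m', (key _ _ _).1 hm'⟩
  · intro h x
    obtain ⟨m, s, rfl⟩ := exists_eq_fraction x
    obtain ⟨m', hm'⟩ := h m s s.2
    exact ⟨m', (key _ _ _).2 hm'⟩

lemma toLocalization_surjective_of_surjective {M N : ModuleCat.{u} A} (f : M →ₗ[A] N)
    (hf : Function.Surjective f) (hM : Function.Surjective (toLocalization S M)) :
    Function.Surjective (toLocalization S N) := by
  rw [toLocalization_surjective_iff] at hM ⊢
  intro n s hs
  obtain ⟨m, rfl⟩ := hf n
  obtain ⟨m', t, ht, h⟩ := hM m s hs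
  exact ⟨f m', t, ht, by rw [← map_smul, ← map_sub, ← map_smul, h, map_zero]⟩

lemma toLocalization_surjective_prod {M N : ModuleCat.{u} A}
    (hM : Function.Surjective (toLocalization S M))
    (hN : Function.Surjective (toLocalization S N)) :
    Function.Surjective (toLocalization S (ModuleCat.of A (M × N))) := by
  rw [toLocalization_surjective_iff] at hM hN ⊢
  rintro ⟨m, n⟩ s hs
  obtain ⟨m', hm⟩ := hM m s hs
  obtain ⟨n', hn⟩ := hN n s hs
  refine ⟨(m', n'), ?_⟩
  have h₁ := torsion_map S (LinearMap.inl A M N) hm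
  have h₂ := torsion_map S (LinearMap.inr A M N) hn
  have h₃ := torsion_add S h₁ h₂
  have h₄ : LinearMap.inl A M N (s • m' - m) + LinearMap.inr A M N (s • n' - n) =
      s • ((m', n') : M × N) - (m, n) := by ext <;> simp
  rwa [h₄] at h₃

/-- Under `A ⊗ M ≅ M`, the differential `A → A_S` of `K(A;S)` becomes the localisation map of `M`.
-/
lemma localizationUnit_naturality_bimod (M : ModuleCat.{u} A) :
    (tensorUnit 𝕂 A).app M ≫ (localizationUnit 𝕂 S).app M =
      ((tensorBifunctor 𝕂 A).map (localizationBimodMap 𝕂 S)).app M := by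
  refine tensor_hom_ext fun a m => ?_
  refine (oreDiv_tmul (𝕂 := 𝕂) (show A from a) (1 : S) m).symm

end Localization

/-! ### Quasi-isomorphisms of complexes of modules in terms of elements. -/

section QuasiIsomorphisms

variable {A : Type u} [Ring A] {K L : CochainComplex (ModuleCat.{u} A) ℤ} (f : K ⟶ L)

/-- Elements are morphisms from the free module `A`; after refining by an epimorphism onto `A`, a
preimage of `1` recovers an element. -/
lemma mono_homologyMap_iff (i j k : ℤ) (hij : i + 1 = j) (hjk : j + 1 = k) :
    Mono (HomologicalComplex.homologyMap f j) ↔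
      ∀ x : K.X j, K.d j k x = 0 → ∀ y : L.X i, L.d i j y = f.f j x → ∃ x', K.d i j x' = x := by
  rw [HomologicalComplex.mono_homologyMap_iff_up_to_refinements f i j k
    (by simp [← hij]) (by simp [← hjk])]
  constructor
  · intro h x hx y hy
    obtain ⟨B, π, hπ, z, hz⟩ := h (ModuleCat.ofHom (LinearMap.toSpanSingleton A _ x))
      (by ext; simpa using hx) (ModuleCat.ofHom (LinearMap.toSpanSingleton A _ y))
      (by ext; simpa using hy.symm)
    obtain ⟨b, hb⟩ := (ModuleCat.epi_iff_surjective π).1 hπ (1 : A)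
    refine ⟨z b, ?_⟩
    have := congrArg (fun k => k.hom b) hz
    simp only [ModuleCat.hom_comp, LinearMap.comp_apply] at this
    rw [← this, hb]
    simp
  · intro h B x hx y hy
    -- Solutions exist pointwise but need not depend linearly on the point, so the refinement of `B`
    -- is the module of all pairs of a point and a solution.
    let P : Submodule A (B × K.X i) := LinearMap.eqLocus (x.hom ∘ₗ LinearMap.fst A _ _)
      ((K.d i j).hom ∘ₗ LinearMap.snd A _ _)
    refine ⟨ModuleCat.of A P, ModuleCat.ofHom (LinearMap.fst A _ _ ∘ₗ P.subtype),
      (ModuleCat.epi_iff_surjective _).2 fun b => ?_,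
      ModuleCat.ofHom (LinearMap.snd A _ _ ∘ₗ P.subtype), ?_⟩
    · obtain ⟨z, hz⟩ := h (x b) (congrArg (fun k => k.hom b) hx) (y b)
        (congrArg (fun k => k.hom b) hy).symm
      exact ⟨⟨(b, z), hz.symm⟩, rfl⟩
    · ext p
      exact p.2

lemma epi_homologyMap_iff (i j k : ℤ) (hij : i + 1 = j) (hjk : j + 1 = k) :
    Epi (HomologicalComplex.homologyMap f j) ↔
      ∀ y : L.X j, L.d j k y = 0 →
        ∃ x : K.X j, K.d j k x = 0 ∧ ∃ y' : L.X i, y = f.f j x + L.d i j y' := by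
  rw [HomologicalComplex.epi_homologyMap_iff_up_to_refinements f i j k
    (by simp [← hij]) (by simp [← hjk])]
  constructor
  · intro h y hy
    obtain ⟨B, π, hπ, x, hx, z, hz⟩ := h (ModuleCat.ofHom (LinearMap.toSpanSingleton A _ y))
      (by ext; simpa using hy)
    obtain ⟨b, hb⟩ := (ModuleCat.epi_iff_surjective π).1 hπ (1 : A)
    refine ⟨x b, congrArg (fun k => k.hom b) hx, z b, ?_⟩
    have := congrArg (fun k => k.hom b) hz
    simp only [ModuleCat.hom_comp, LinearMap.comp_apply] at this
    rw [hb] at this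
    simpa using this
  · intro h B y hy
    let P : Submodule A (B × K.X j × L.X i) :=
      LinearMap.eqLocus (y.hom ∘ₗ LinearMap.fst A _ _)
        (((f.f j).hom ∘ₗ LinearMap.fst A _ _ + (L.d i j).hom ∘ₗ LinearMap.snd A _ _) ∘ₗ
          LinearMap.snd A _ _) ⊓
      LinearMap.ker ((K.d j k).hom ∘ₗ LinearMap.fst A _ _ ∘ₗ LinearMap.snd A _ _)
    refine ⟨ModuleCat.of A P, ModuleCat.ofHom (LinearMap.fst A _ _ ∘ₗ P.subtype),
      (ModuleCat.epi_iff_surjective _).2 fun b => ?_,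
      ModuleCat.ofHom (LinearMap.fst A _ _ ∘ₗ LinearMap.snd A _ _ ∘ₗ P.subtype), ?_,
      ModuleCat.ofHom (LinearMap.snd A _ _ ∘ₗ LinearMap.snd A _ _ ∘ₗ P.subtype), ?_⟩
    · obtain ⟨x, hx, z, hz⟩ := h (y b) (congrArg (fun k => k.hom b) hy)
      exact ⟨⟨(b, x, z), hz, hx⟩, rfl⟩
    · ext p
      exact p.2.2
    · ext p
      exact p.2.1

lemma quasiIso_iff_elements : QuasiIso f ↔ ∀ i j k : ℤ, i + 1 = j → j + 1 = k →
    (∀ x : K.X j, K.d j k x = 0 → ∀ y : L.X i, L.d i j y = f.f j x → ∃ x', K.d i j x' = x) ∧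
    (∀ y : L.X j, L.d j k y = 0 →
        ∃ x : K.X j, K.d j k x = 0 ∧ ∃ y' : L.X i, y = f.f j x + L.d i j y') := by
  rw [quasiIso_iff]
  constructor
  · intro h i j k hij hjk
    have := (quasiIsoAt_iff_isIso_homologyMap f j).1 (h j)
    exact ⟨(mono_homologyMap_iff f i j k hij hjk).1 inferInstance,
      (epi_homologyMap_iff f i j k hij hjk).1 inferInstance⟩
  · intro h j
    obtain ⟨h₁, h₂⟩ := h (j - 1) j (j + 1) (by omega) rfl
    have := (mono_homologyMap_iff f (j - 1) j (j + 1) (by omega) rfl).2 h₁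
    have := (epi_homologyMap_iff f (j - 1) j (j + 1) (by omega) rfl).2 h₂
    exact (quasiIsoAt_iff_isIso_homologyMap f j).2 (isIso_of_mono_of_epi _)

lemma d_d_apply (i j k : ℤ) (x : K.X i) : K.d j k (K.d i j x) = 0 :=
  congrArg (fun g => g.hom x) (K.d_comp_d i j k)

lemma hom_d_apply (i j : ℤ) (x : K.X i) : f.f j (K.d i j x) = L.d i j (f.f i x) :=
  (congrArg (fun g => g.hom x) (f.comm i j)).symm

end QuasiIsomorphisms

/-! ### Homotopy fibers and their invariance under quasi-isomorphisms. -/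

section Fiber

variable {A : Type u} [Ring A] {X Y : CochainComplex (ModuleCat.{u} A) ℤ} (φ : X ⟶ Y)

/-- The homotopy fiber of a morphism `φ : X ⟶ Y` of complexes of modules: in degree `n` it is
`X^n × Y^(n-1)`, with differential `(x, y) ↦ (d x, φ x - d y)`. -/
def fiber : CochainComplex (ModuleCat.{u} A) ℤ where
  X n := ModuleCat.of A (X.X n × Y.X (n - 1))
  d i j := ModuleCat.ofHom <|
    if h : i + 1 = j then
      ((X.d i j).hom ∘ₗ LinearMap.fst A _ _).prod
        ((φ.f i ≫ (Y.XIsoOfEq (show i = j - 1 by omega)).hom).hom ∘ₗ LinearMap.fst A _ _ -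
          (Y.d (i - 1) (j - 1)).hom ∘ₗ LinearMap.snd A _ _)
    else 0
  shape i j h := by
    rw [dif_neg (show ¬ i + 1 = j from h)]
    rfl
  d_comp_d' i j k hij hjk := by
    obtain rfl : i + 1 = j := hij
    obtain rfl : i + 1 + 1 = k := hjk
    rw [dif_pos rfl, dif_pos rfl]
    refine ModuleCat.hom_ext (LinearMap.ext fun ⟨x, y⟩ => ?_)
    refine Prod.ext (d_d_apply _ _ _ x) ?_
    have h₁ := congrArg (fun g => g.hom x) (show X.d i (i + 1) ≫ φ.f (i + 1) ≫
        (Y.XIsoOfEq (show i + 1 = i + 1 + 1 - 1 by omega)).hom =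
      (φ.f i ≫ (Y.XIsoOfEq (show i = i + 1 - 1 by omega)).hom) ≫
        Y.d (i + 1 - 1) (i + 1 + 1 - 1) by
      rw [← φ.comm_assoc, Category.assoc, HomologicalComplex.XIsoOfEq_hom_comp_d,
        HomologicalComplex.d_comp_XIsoOfEq_hom])
    have h₂ := d_d_apply (K := Y) (i - 1) (i + 1 - 1) (i + 1 + 1 - 1) y
    change (φ.f (i + 1) ≫ (Y.XIsoOfEq (show i + 1 = i + 1 + 1 - 1 by omega)).hom).hom
      (X.d i (i + 1) x) - Y.d (i + 1 - 1) (i + 1 + 1 - 1)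
        ((φ.f i ≫ (Y.XIsoOfEq (show i = i + 1 - 1 by omega)).hom).hom x -
          Y.d (i - 1) (i + 1 - 1) y) = 0
    rw [map_sub, h₂, sub_zero, sub_eq_zero]
    exact h₁

/-- The elements of the fiber in degree `j = i + 1`. -/
def fiberEquiv (i j : ℤ) (h : i + 1 = j) : (X.X j × Y.X i) ≃ₗ[A] (fiber φ).X j :=
  (LinearEquiv.refl A (X.X j)).prodCongr
    (Y.XIsoOfEq (show i = j - 1 by omega)).toLinearEquiv

/-- Indexing the second coordinate by any `i` with `i + 1 = j` keeps the transports along `i = j -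
1` out of all later computations. -/
lemma fiber_d (i j k : ℤ) (hij : i + 1 = j) (hjk : j + 1 = k) (x : X.X j) (y : Y.X i) :
    (fiber φ).d j k (fiberEquiv φ i j hij (x, y)) =
      fiberEquiv φ j k hjk (X.d j k x, φ.f j x - Y.d i j y) := by
  obtain rfl : i = j - 1 := by omega
  subst hjk
  have hd : (fiber φ).d j (j + 1) = ModuleCat.ofHom
      (((X.d j (j + 1)).hom ∘ₗ LinearMap.fst A _ _).prod
        ((φ.f j ≫ (Y.XIsoOfEq (show j = j + 1 - 1 by omega)).hom).hom ∘ₗ LinearMap.fst A _ _ -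
          (Y.d (j - 1) (j + 1 - 1)).hom ∘ₗ LinearMap.snd A _ _)) := by
    dsimp only [fiber]
    rw [dif_pos rfl]
  rw [hd]
  refine Prod.ext rfl ?_
  have h₁ := congrArg (fun g => g.hom y) (show (Y.XIsoOfEq (rfl : j - 1 = j - 1)).hom ≫
    Y.d (j - 1) (j + 1 - 1) = Y.d (j - 1) j ≫ (Y.XIsoOfEq (show j = j + 1 - 1 by omega)).hom by
      simp)
  exact (congrArg (_ - ·) h₁).trans
    (map_sub (Y.XIsoOfEq (show j = j + 1 - 1 by omega)).hom.hom _ _).symm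

lemma exists_eq_fiberEquiv (i j : ℤ) (h : i + 1 = j) (z : (fiber φ).X j) :
    ∃ x y, z = fiberEquiv φ i j h (x, y) :=
  ⟨((fiberEquiv φ i j h).symm z).1, ((fiberEquiv φ i j h).symm z).2, by simp⟩

lemma fiberEquiv_eq_iff (i j : ℤ) (h : i + 1 = j) (x x' : X.X j) (y y' : Y.X i) :
    fiberEquiv φ i j h (x, y) = fiberEquiv φ i j h (x', y') ↔ x = x' ∧ y = y' := by
  rw [(fiberEquiv φ i j h).injective.eq_iff, Prod.mk.injEq]

lemma fiberEquiv_eq_zero_iff (i j : ℤ) (h : i + 1 = j) (x : X.X j) (y : Y.X i) :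
    fiberEquiv φ i j h (x, y) = 0 ↔ x = 0 ∧ y = 0 := by
  rw [LinearEquiv.map_eq_zero_iff, Prod.mk_eq_zero]

/-- The projection from the fiber of `X ⟶ Y` to `X`. -/
def fiberFst : fiber φ ⟶ X where
  f n := ModuleCat.ofHom (LinearMap.fst A (X.X n) (Y.X (n - 1)))
  comm' i j hij := by
    ext z
    obtain ⟨x, y, rfl⟩ := exists_eq_fiberEquiv φ (i - 1) i (by omega) z
    exact (congrArg (fun z : X.X j × Y.X (j - 1) => z.1)
      (fiber_d φ (i - 1) i j (by omega) hij x y)).symm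

variable {φ} {N : CochainComplex (ModuleCat.{u} A) ℤ}

/-- The morphism to the fiber of `φ : X ⟶ Y` induced by a morphism `N ⟶ X` that is killed
by `φ`. -/
def fiberLift (ι : N ⟶ X) (h : ι ≫ φ = 0) : N ⟶ fiber φ where
  f n := ModuleCat.ofHom (LinearMap.inl A (X.X n) (Y.X (n - 1)) ∘ₗ (ι.f n).hom)
  comm' i j hij := by
    ext z
    have h₁ : (fiber φ).d i j (fiberEquiv φ (i - 1) i (by omega) (ι.f i z, 0)) =
      fiberEquiv φ (j - 1) j (by omega) (ι.f j (N.d i j z), 0) := by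
      obtain rfl : i = j - 1 := (show i + 1 = j from hij) ▸ by omega
      rw [fiber_d φ (j - 1 - 1) (j - 1) j (by omega) (by omega), fiberEquiv_eq_iff, map_zero,
        sub_zero, hom_d_apply]
      exact ⟨rfl, congrArg (fun g => (g.f (j - 1)).hom z) h⟩
    have h₂ (n : ℤ) (x : X.X n) : fiberEquiv φ (n - 1) n (by omega) (x, 0) =
      LinearMap.inl A (X.X n) (Y.X (n - 1)) x :=
      Prod.ext rfl (map_zero (Y.XIsoOfEq (rfl : n - 1 = n - 1)).hom.hom)
    rw [h₂, h₂] at h₁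
    exact h₁

lemma fiberLift_apply (ι : N ⟶ X) (h : ι ≫ φ = 0) (i j : ℤ) (hij : i + 1 = j) (n : N.X j) :
    (fiberLift ι h).f j n = fiberEquiv φ i j hij (ι.f j n, 0) := 
  Prod.ext rfl (map_zero (Y.XIsoOfEq (show i = j - 1 by omega)).hom.hom).symm

@[simp]
lemma fiberLift_fst (ι : N ⟶ X) (h : ι ≫ φ = 0) : fiberLift ι h ≫ fiberFst φ = ι := rfl

/-- When `0 → N → X → Y → 0` is exact in each degree, the homotopy fiber reduces to the kernel.
Given a cycle `(x, y)` with `y = φ c`, subtracting the boundary of `(c, 0)` leaves `(x - d c, 0)`,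
which comes from `N`. -/
lemma quasiIso_fiberLift (ι : N ⟶ X) (h : ι ≫ φ = 0)
    (h₁ : ∀ n, Function.Injective (ι.f n))
    (h₂ : ∀ n (x : X.X n), φ.f n x = 0 → ∃ z, ι.f n z = x)
    (h₃ : ∀ n, Function.Surjective (φ.f n)) : QuasiIso (fiberLift ι h) := by
  rw [quasiIso_iff_elements]
  intro i j k hij hjk
  constructor
  · intro z hz w hw
    obtain ⟨x, y, rfl⟩ := exists_eq_fiberEquiv φ (i - 1) i (by omega) w
    rw [fiberLift_apply ι h i j hij, fiber_d φ (i - 1) i j (by omega) hij, fiberEquiv_eq_iff] at hw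
    obtain ⟨hw₁, hw₂⟩ := hw
    obtain ⟨c, rfl⟩ := h₃ _ y
    obtain ⟨z', hz'⟩ := h₂ i (x - X.d (i - 1) i c) (by rw [map_sub, hom_d_apply, hw₂])
    refine ⟨z', h₁ j ?_⟩
    rw [hom_d_apply, hz', map_sub, d_d_apply, sub_zero, hw₁]
  · intro w hw
    obtain ⟨x, y, rfl⟩ := exists_eq_fiberEquiv φ i j hij w
    rw [fiber_d φ i j k hij hjk, fiberEquiv_eq_zero_iff] at hw
    obtain ⟨hw₁, hw₂⟩ := hw
    obtain ⟨c, rfl⟩ := h₃ _ y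
    obtain ⟨z, hz⟩ := h₂ j (x - X.d i j c) (by rw [map_sub, hom_d_apply, hw₂])
    refine ⟨z, h₁ k ?_, fiberEquiv φ (i - 1) i (by omega) (c, 0), ?_⟩
    · rw [hom_d_apply, hz, map_sub, d_d_apply, sub_zero, hw₁, map_zero]
    · rw [fiberLift_apply ι h i j hij, fiber_d φ (i - 1) i j (by omega) hij, ← map_add,
        Prod.mk_add_mk, fiberEquiv_eq_iff, hz]
      simp

variable {X' Y' : CochainComplex (ModuleCat.{u} A) ℤ} {φ' : X' ⟶ Y'}

/-- The morphism between fibers induced by a commutative square. -/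
def fiberMap (α : X ⟶ X') (β : Y ⟶ Y') (h : φ ≫ β = α ≫ φ') : fiber φ ⟶ fiber φ' where
  f n := ModuleCat.ofHom ((α.f n).hom.prodMap (β.f (n - 1)).hom)
  comm' i j hij := by
    obtain rfl : i + 1 = j := hij
    refine ModuleCat.hom_ext (LinearMap.ext fun z => ?_)
    obtain ⟨x, y, rfl⟩ := exists_eq_fiberEquiv φ (i - 1) i (by omega) z
    have hm (p q : ℤ) (hpq : p + 1 = q) (x : X.X q) (y : Y.X p) :
        (α.f q).hom.prodMap (β.f (q - 1)).hom (fiberEquiv φ p q hpq (x, y)) =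
          fiberEquiv φ' p q hpq (α.f q x, β.f p y) := by
      refine Prod.ext rfl ?_
      exact congrArg (fun g => g.hom y)
        (show (Y.XIsoOfEq (show p = q - 1 by omega)).hom ≫ β.f (q - 1) =
          β.f p ≫ (Y'.XIsoOfEq (show p = q - 1 by omega)).hom by
            obtain rfl : p = q - 1 := by omega
            simp)
    have h₁ : (fiber φ').d i (i + 1) (fiberEquiv φ' (i - 1) i (by omega)
        (α.f i x, β.f (i - 1) y)) = fiberEquiv φ' i (i + 1) rfl
          (α.f (i + 1) (X.d i (i + 1) x), β.f i (φ.f i x - Y.d (i - 1) i y)) := by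
      rw [fiber_d φ' (i - 1) i (i + 1) (by omega) rfl, fiberEquiv_eq_iff, hom_d_apply, map_sub,
        hom_d_apply]
      exact ⟨rfl, congrArg (· - _) (congrArg (fun g => (g.f i).hom x) h).symm⟩
    rw [← hm, ← hm, ← fiber_d φ (i - 1) i (i + 1) (by omega) rfl] at h₁
    exact h₁

lemma fiberMap_apply (α : X ⟶ X') (β : Y ⟶ Y') (h : φ ≫ β = α ≫ φ') (i j : ℤ) (hij : i + 1 = j)
    (x : X.X j) (y : Y.X i) : (fiberMap α β h).f j (fiberEquiv φ i j hij (x, y)) =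
      fiberEquiv φ' i j hij (α.f j x, β.f i y) := by
  refine Prod.ext rfl ?_
  exact congrArg (fun g => g.hom y)
    (show (Y.XIsoOfEq (show i = j - 1 by omega)).hom ≫ β.f (j - 1) =
      β.f i ≫ (Y'.XIsoOfEq (show i = j - 1 by omega)).hom by
        obtain rfl : i = j - 1 := by omega
        simp)

/-- The five lemma for the long exact sequences of the two fibers, carried out on elements. -/
lemma quasiIso_fiberMap (α : X ⟶ X') (β : Y ⟶ Y') (h : φ ≫ β = α ≫ φ') (hα : QuasiIso α)
    (hβ : QuasiIso β) : QuasiIso (fiberMap α β h) := by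
  rw [quasiIso_iff_elements] at hα hβ ⊢
  have hc (n : ℤ) (x : X.X n) : β.f n (φ.f n x) = φ'.f n (α.f n x) :=
    congrArg (fun g => (g.f n).hom x) h
  intro i j k hij hjk
  have hi : i - 1 + 1 = i := by omega
  constructor
  · intro z hz w hw
    obtain ⟨x, y, rfl⟩ := exists_eq_fiberEquiv φ i j hij z
    obtain ⟨x', y', rfl⟩ := exists_eq_fiberEquiv φ' (i - 1) i (by omega) w
    rw [fiber_d φ i j k hij hjk, fiberEquiv_eq_zero_iff] at hz
    rw [fiberMap_apply, fiber_d φ' (i - 1) i j (by omega) hij, fiberEquiv_eq_iff] at hw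
    obtain ⟨hz₁, hz₂⟩ := hz
    obtain ⟨hw₁, hw₂⟩ := hw
    obtain ⟨a, rfl⟩ := (hα i j k hij hjk).1 x hz₁ x' hw₁
    -- replace `x'` by a cycle
    obtain ⟨c, hc₁, c', hc'⟩ := (hα (i - 1) i j hi hij).2 (x' - α.f i a) (by
      rw [map_sub, hw₁, hom_d_apply, sub_self])
    obtain ⟨b, hb⟩ := (hβ (i - 1) i j hi hij).1 (φ.f i (a + c) - y) (by
      rw [map_sub, ← hom_d_apply, map_add, hc₁, add_zero, sub_eq_zero]
      exact sub_eq_zero.1 hz₂) (y' - φ'.f (i - 1) c') (by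
      have hx' : x' = α.f i a + α.f i c + X'.d (i - 1) i c' := by
        rw [add_assoc, ← hc']; abel
      rw [map_sub, ← hom_d_apply, map_sub, ← hw₂, hc, hx']
      simp only [map_add]
      abel)
    refine ⟨fiberEquiv φ (i - 1) i hi (a + c, b), ?_⟩
    rw [fiber_d φ (i - 1) i j hi hij, fiberEquiv_eq_iff, hb, map_add, hc₁]
    simp
  · intro w hw
    obtain ⟨x', y', rfl⟩ := exists_eq_fiberEquiv φ' i j hij w
    rw [fiber_d φ' i j k hij hjk, fiberEquiv_eq_zero_iff] at hw
    obtain ⟨hw₁, hw₂⟩ := hw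
    obtain ⟨x, hx, c', rfl⟩ := (hα i j k hij hjk).2 x' hw₁
    obtain ⟨b, hb⟩ := (hβ i j k hij hjk).1 (φ.f j x) (by rw [← hom_d_apply, hx, map_zero])
      (y' - φ'.f i c') (by
        rw [map_sub, ← hom_d_apply, hc, ← sub_eq_zero.1 hw₂, map_add]
        abel)
    -- The element `b` makes the lift `(x, b)` a cycle, but its image may miss the class of `(x',
    -- y')` by a cycle of `Y'`. Lifting that cycle to `e`, up to a boundary, corrects the second
    -- coordinate.
    obtain ⟨e, he, e', he'⟩ := (hβ (i - 1) i j hi hij).2 (y' - φ'.f i c' - β.f i b) (by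
      rw [map_sub, map_sub, ← hom_d_apply, ← hom_d_apply, hb, hc, ← sub_eq_zero.1 hw₂, map_add]
      abel)
    refine ⟨fiberEquiv φ i j hij (x, b + e), ?_,
      fiberEquiv φ' (i - 1) i hi (c', -e'), ?_⟩
    · rw [fiber_d φ i j k hij hjk, fiberEquiv_eq_zero_iff, map_add, hb, he]
      exact ⟨hx, by simp⟩
    · rw [fiberMap_apply, fiber_d φ' (i - 1) i j hi hij, ← map_add, Prod.mk_add_mk,
        fiberEquiv_eq_iff, map_neg, sub_neg_eq_add]
      refine ⟨rfl, ?_⟩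
      rw [map_add]
      have : y' = φ'.f i c' + β.f i b + (β.f i e + Y'.d (i - 1) i e') := by rw [← he']; abel
      rw [this]
      abel

variable {C : Type*} [Category* C] {F G : C ⥤ CochainComplex (ModuleCat.{u} A) ℤ} (τ : F ⟶ G)

/-- The fiber of a natural transformation between functors to complexes. -/
def fiberFunctor : C ⥤ CochainComplex (ModuleCat.{u} A) ℤ where
  obj c := fiber (τ.app c)
  map g := fiberMap (F.map g) (G.map g) (τ.naturality g).symm
  map_id c := by
    ext n : 1
    refine ModuleCat.hom_ext (LinearMap.ext fun z => ?_)
    obtain ⟨x, y, rfl⟩ := exists_eq_fiberEquiv _ (n - 1) n (by omega) z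
    refine (fiberMap_apply _ _ _ _ _ _ x y).trans ?_
    rw [F.map_id, G.map_id]
    rfl
  map_comp g g' := by
    ext n : 1
    refine ModuleCat.hom_ext (LinearMap.ext fun z => ?_)
    obtain ⟨x, y, rfl⟩ := exists_eq_fiberEquiv _ (n - 1) n (by omega) z
    refine (fiberMap_apply _ _ _ _ _ _ x y).trans ?_
    rw [F.map_comp, G.map_comp]
    rfl

end Fiber

/-! ### `K(A;S) ⊗ M` as the homotopy fiber of `M → A_S ⊗ M`. -/

section LocalizationTensor

variable (𝕂 : Type v) [CommRing 𝕂] {A : Type u} [Ring A] [Algebra 𝕂 A]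
  (S : Submonoid A) [OreLocalization.OreSet S]

/-- The localisation of a complex. -/
abbrev complexLocalization :
    CochainComplex (ModuleCat.{u} A) ℤ ⥤ CochainComplex (ModuleCat.{u} A) ℤ :=
  (localizationFunctor 𝕂 S).mapHomologicalComplex (ComplexShape.up ℤ)

/-- The localisation map of a complex. -/
def complexLocalizationUnitApp (M : CochainComplex (ModuleCat.{u} A) ℤ) :
    M ⟶ (complexLocalization 𝕂 S).obj M where
  f n := (localizationUnit 𝕂 S).app (M.X n)
  comm' _ _ _ := ((localizationUnit 𝕂 S).naturality _).symm

lemma complexLocalizationUnitApp_naturality {M M' : CochainComplex (ModuleCat.{u} A) ℤ}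
    (f : M ⟶ M') : f ≫ complexLocalizationUnitApp 𝕂 S M' =
      complexLocalizationUnitApp 𝕂 S M ≫ (complexLocalization 𝕂 S).map f := by
  ext n : 1
  exact (localizationUnit 𝕂 S).naturality (f.f n)

/-- The localisation maps for complexes, as a natural transformation. -/
def complexLocalizationUnit :
    𝟭 (CochainComplex (ModuleCat.{u} A) ℤ) ⟶ complexLocalization 𝕂 S where
  app := complexLocalizationUnitApp 𝕂 S
  naturality _ _ f := complexLocalizationUnitApp_naturality 𝕂 S f

/-- The functor sending a complex `M` to the fiber of `M ⟶ A_S ⊗ M`. -/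
abbrev localizationFiber :
    CochainComplex (ModuleCat.{u} A) ℤ ⥤ CochainComplex (ModuleCat.{u} A) ℤ :=
  fiberFunctor (complexLocalizationUnit 𝕂 S)

variable {𝕂 S}

/-- The canonical isomorphism of the term of degree `0` of `K(A;S)` with `A`. -/
abbrev localizationComplexXZero : (localizationComplex 𝕂 S).X 0 ≅ regularBimod 𝕂 A :=
  HomologicalComplex.doubleXIso₀ (localizationBimodMap 𝕂 S) _

/-- The canonical isomorphism of the term of degree `1` of `K(A;S)` with `A_S`. -/
abbrev localizationComplexXOne : (localizationComplex 𝕂 S).X 1 ≅ localizedBimod 𝕂 S :=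
  HomologicalComplex.doubleXIso₁ (localizationBimodMap 𝕂 S) _ zero_ne_one

lemma isZero_tensorBifunctor_obj {N : BimodCat 𝕂 A} (hN : IsZero N) (M : ModuleCat.{u} A) :
    IsZero (((tensorBifunctor 𝕂 A).obj N).obj M) := by
  rw [IsZero.iff_id_eq_zero]
  have := congrArg (fun f => ((tensorBifunctor 𝕂 A).map f).app M) (hN.eq_of_src (𝟙 _) 0)
  simpa using this

lemma isZero_localizationComplex_X (p : ℤ) (h₀ : p ≠ 0) (h₁ : p ≠ 1) :
    IsZero ((localizationComplex 𝕂 S).X p) :=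
  HomologicalComplex.isZero_double_X _ _ _ h₀ h₁

variable (𝕂 S) in
/-- The complex `K(A;S) ⊗_A M`. -/
abbrev localizationTensor (M : CochainComplex (ModuleCat.{u} A) ℤ) :
    CochainComplex (ModuleCat.{u} A) ℤ :=
  HomologicalComplex.mapBifunctor (localizationComplex 𝕂 S) M (tensorBifunctor 𝕂 A)
    (ComplexShape.up ℤ)

lemma localizationTensor_hom_ext {M : CochainComplex (ModuleCat.{u} A) ℤ} {n m : ℤ}
    (h : m + 1 = n) {P : ModuleCat.{u} A} {f g : (localizationTensor 𝕂 S M).X n ⟶ P}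
    (h₀ : HomologicalComplex.ιMapBifunctor (localizationComplex 𝕂 S) M (tensorBifunctor 𝕂 A)
        (ComplexShape.up ℤ) 0 n n (zero_add n) ≫ f =
      HomologicalComplex.ιMapBifunctor (localizationComplex 𝕂 S) M (tensorBifunctor 𝕂 A)
        (ComplexShape.up ℤ) 0 n n (zero_add n) ≫ g)
    (h₁ : HomologicalComplex.ιMapBifunctor (localizationComplex 𝕂 S) M (tensorBifunctor 𝕂 A)
        (ComplexShape.up ℤ) 1 m n ((add_comm _ _).trans h) ≫ f =
      HomologicalComplex.ιMapBifunctor (localizationComplex 𝕂 S) M (tensorBifunctor 𝕂 A)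
        (ComplexShape.up ℤ) 1 m n ((add_comm _ _).trans h) ≫ g) : f = g := by
  refine HomologicalComplex.mapBifunctor.hom_ext fun p q hpq => ?_
  have hpq' : p + q = n := hpq
  by_cases hp₀ : p = 0
  · subst hp₀
    obtain rfl : q = n := by omega
    exact h₀
  by_cases hp₁ : p = 1
  · subst hp₁
    obtain rfl : q = m := by omega
    exact h₁
  exact (isZero_tensorBifunctor_obj (isZero_localizationComplex_X p hp₀ hp₁) _).eq_of_src _ _

variable (M : CochainComplex (ModuleCat.{u} A) ℤ)

/-- The inclusion of `A ⊗ M^n` into `(K(A;S) ⊗ M)^n`. -/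
def tensorInl (n : ℤ) : ((tensorBifunctor 𝕂 A).obj (regularBimod 𝕂 A)).obj (M.X n) ⟶
    (localizationTensor 𝕂 S M).X n :=
  ((tensorBifunctor 𝕂 A).map localizationComplexXZero.inv).app (M.X n) ≫
    HomologicalComplex.ιMapBifunctor (localizationComplex 𝕂 S) M (tensorBifunctor 𝕂 A)
      (ComplexShape.up ℤ) 0 n n (zero_add n)

/-- The inclusion of `A_S ⊗ M^m` into `(K(A;S) ⊗ M)^n`, where `m + 1 = n`. -/
def tensorInr (m n : ℤ) (h : m + 1 = n) : (localizationFunctor 𝕂 S).obj (M.X m) ⟶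
    (localizationTensor 𝕂 S M).X n :=
  ((tensorBifunctor 𝕂 A).map localizationComplexXOne.inv).app (M.X m) ≫
    HomologicalComplex.ιMapBifunctor (localizationComplex 𝕂 S) M (tensorBifunctor 𝕂 A)
      (ComplexShape.up ℤ) 1 m n ((add_comm _ _).trans h)

variable {M}

lemma map_hom_comp_tensorInl (n : ℤ) :
    ((tensorBifunctor 𝕂 A).map localizationComplexXZero.hom).app (M.X n) ≫ tensorInl (S := S) M n =
    HomologicalComplex.ιMapBifunctor (localizationComplex 𝕂 S) M (tensorBifunctor 𝕂 A)
      (ComplexShape.up ℤ) 0 n n (zero_add n) := by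
  rw [tensorInl, ← Category.assoc, ← NatTrans.comp_app, ← Functor.map_comp, Iso.hom_inv_id,
    CategoryTheory.Functor.map_id, NatTrans.id_app, Category.id_comp]

lemma map_hom_comp_tensorInr (m n : ℤ) (h : m + 1 = n) :
    ((tensorBifunctor 𝕂 A).map localizationComplexXOne.hom).app (M.X m) ≫
      tensorInr (S := S) M m n h =
    HomologicalComplex.ιMapBifunctor (localizationComplex 𝕂 S) M (tensorBifunctor 𝕂 A)
      (ComplexShape.up ℤ) 1 m n ((add_comm _ _).trans h) := by
  rw [tensorInr, ← Category.assoc, ← NatTrans.comp_app, ← Functor.map_comp, Iso.hom_inv_id,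
    CategoryTheory.Functor.map_id, NatTrans.id_app, Category.id_comp]

lemma localizationTensor_hom_ext' {n m : ℤ} (h : m + 1 = n)
    {P : ModuleCat.{u} A} {f g : (localizationTensor 𝕂 S M).X n ⟶ P}
    (h₀ : tensorInl M n ≫ f = tensorInl M n ≫ g)
    (h₁ : tensorInr M m n h ≫ f = tensorInr M m n h ≫ g) : f = g := by
  refine localizationTensor_hom_ext h ?_ ?_
  · rw [← map_hom_comp_tensorInl, Category.assoc, h₀, Category.assoc]
  · rw [← map_hom_comp_tensorInr m n h, Category.assoc, h₁, Category.assoc]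

lemma tensorInl_d (n n' : ℤ) (h : n + 1 = n') :
    tensorInl M n ≫ (localizationTensor 𝕂 S M).d n n' =
      ((tensorBifunctor 𝕂 A).map (localizationBimodMap 𝕂 S)).app (M.X n) ≫ tensorInr M n n' h +
      ((tensorBifunctor 𝕂 A).obj (regularBimod 𝕂 A)).map (M.d n n') ≫ tensorInl M n' := by
  have hK : (localizationComplex 𝕂 S).d 0 1 = localizationComplexXZero.hom ≫
    localizationBimodMap 𝕂 S ≫ localizationComplexXOne.inv :=
      HomologicalComplex.double_d _ _ zero_ne_one
  rw [tensorInl, Category.assoc, HomologicalComplex.mapBifunctor.d_eq, Preadditive.comp_add,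
    HomologicalComplex.mapBifunctor.ι_D₁, HomologicalComplex.mapBifunctor.ι_D₂,
    HomologicalComplex.mapBifunctor.d₁_eq _ _ _ _ (show (ComplexShape.up ℤ).Rel 0 1 from rfl) n n'
      ((add_comm _ _).trans h),
    HomologicalComplex.mapBifunctor.d₂_eq _ _ _ _ 0 (show (ComplexShape.up ℤ).Rel n n' from h) n'
      (zero_add n'), hK, Preadditive.comp_add, tensorInr, tensorInl]
  simp

/-- The sign is `(-1)^p` for `p = 1`; it is the reason for the minus sign in the differential of
`fiber`. -/
lemma tensorInr_d (m n n' : ℤ) (h : m + 1 = n) (h' : n + 1 = n') :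
    tensorInr M m n h ≫ (localizationTensor 𝕂 S M).d n n' =
      -((localizationFunctor 𝕂 S).map (M.d m n) ≫ tensorInr M n n' h') := by
  have hK : (localizationComplex 𝕂 S).d 1 2 = 0 :=
    HomologicalComplex.double_d_eq_zero₀ _ _ _ _ one_ne_zero
  rw [tensorInr, Category.assoc, HomologicalComplex.mapBifunctor.d_eq, Preadditive.comp_add,
    HomologicalComplex.mapBifunctor.ι_D₁, HomologicalComplex.mapBifunctor.ι_D₂,
    HomologicalComplex.mapBifunctor.d₁_eq' _ _ _ _ (show (ComplexShape.up ℤ).Rel 1 2 from rfl),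
    HomologicalComplex.mapBifunctor.d₂_eq _ _ _ _ 1 (show (ComplexShape.up ℤ).Rel m n from h) n'
      ((add_comm _ _).trans h'), hK, tensorInr]
  simp

variable (𝕂 S M) in
/-- The canonical projection `K(A;S) ⊗ M ⟶ M`. -/
abbrev tensorFst : localizationTensor 𝕂 S M ⟶ M :=
  HomologicalComplex.mapBifunctorMap (localizationComplexToRegular 𝕂 S) (𝟙 M) (tensorBifunctor 𝕂 A)
    (ComplexShape.up ℤ) ≫ complexTensorUnitApp 𝕂 M

lemma tensorInl_fst (n : ℤ) :
    tensorInl M n ≫ (tensorFst 𝕂 S M).f n = (tensorUnit 𝕂 A).app (M.X n) := by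
  rw [tensorInl, HomologicalComplex.comp_f, Category.assoc,
    HomologicalComplex.ι_mapBifunctorMap_assoc]
  dsimp only [complexTensorUnitApp]
  rw [HomologicalComplex.ι_mapBifunctorDesc]
  have h : localizationComplexXZero.inv ≫ (localizationComplexToRegular 𝕂 S).f 0 ≫
      (HomologicalComplex.singleObjXIsoOfEq (ComplexShape.up ℤ) 0 (regularBimod 𝕂 A) 0 rfl).hom =
      𝟙 _ := by
    have h₀ : (localizationComplexToRegular 𝕂 S).f 0 = localizationComplexXZero.hom ≫
        (HomologicalComplex.singleObjXSelf (ComplexShape.up ℤ) 0 (regularBimod 𝕂 A)).inv :=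
      HomologicalComplex.mkHomToSingle_f _ _
    rw [h₀, Category.assoc, Iso.inv_hom_id_assoc]
    exact (HomologicalComplex.singleObjXSelf (ComplexShape.up ℤ) 0 (regularBimod 𝕂 A)).inv_hom_id
  have h' := congrArg (fun f => ((tensorBifunctor 𝕂 A).map f).app (M.X n)) h
  simp only [Functor.map_comp, NatTrans.comp_app, CategoryTheory.Functor.map_id,
    NatTrans.id_app] at h'
  have h'' := congrArg (· ≫ (tensorUnit 𝕂 A).app (M.X n)) h'
  simp only [Category.assoc] at h''
  simpa [complexTensorUnitComponent] using h''

lemma tensorInr_fst (m n : ℤ) (h : m + 1 = n) :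
    tensorInr M m n h ≫ (tensorFst 𝕂 S M).f n = 0 := by
  rw [tensorInr, HomologicalComplex.comp_f, Category.assoc,
    HomologicalComplex.ι_mapBifunctorMap_assoc]
  dsimp only [complexTensorUnitApp]
  rw [HomologicalComplex.ι_mapBifunctorDesc]
  simp [complexTensorUnitComponent]

variable (𝕂 S M) in
/-- The projection of `(K(A;S) ⊗ M)^n` to `A_S ⊗ M^m`, where `m + 1 = n`. -/
def tensorSnd (m n : ℤ) (h : m + 1 = n) :
    (localizationTensor 𝕂 S M).X n ⟶
      (localizationFunctor 𝕂 S).obj (M.X m) :=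
  HomologicalComplex.mapBifunctorDesc fun p q hpq =>
    if hp : p = 1 then
      ((tensorBifunctor 𝕂 A).map (((localizationComplex 𝕂 S).XIsoOfEq hp).hom ≫
        localizationComplexXOne.hom)).app (M.X q) ≫
        (localizationFunctor 𝕂 S).map (M.XIsoOfEq (by
          have hpq' : p + q = n := hpq
          omega)).hom
    else 0

lemma tensorInl_snd (m n : ℤ) (h : m + 1 = n) :
    tensorInl M n ≫ tensorSnd 𝕂 S M m n h = 0 := by
  rw [tensorInl, tensorSnd, Category.assoc, HomologicalComplex.ι_mapBifunctorDesc,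
    dif_neg (by norm_num), comp_zero]

lemma tensorInr_snd (m n : ℤ) (h : m + 1 = n) :
    tensorInr M m n h ≫ tensorSnd 𝕂 S M m n h = 𝟙 _ := by
  rw [tensorInr, tensorSnd, Category.assoc, HomologicalComplex.ι_mapBifunctorDesc, dif_pos rfl]
  simp

/-- The right-hand side is the second coordinate of the differential of the fiber, so the pair of
projections is a morphism of complexes. -/
lemma tensorSnd_d (l m n : ℤ) (h : l + 1 = m) (h' : m + 1 = n) :
    (localizationTensor 𝕂 S M).d m n ≫ tensorSnd 𝕂 S M m n h' =
      (tensorFst 𝕂 S M).f m ≫ (localizationUnit 𝕂 S).app (M.X m) -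
        tensorSnd 𝕂 S M l m h ≫ (localizationFunctor 𝕂 S).map (M.d l m) := by
  refine localizationTensor_hom_ext' h ?_ ?_
  · rw [← Category.assoc, tensorInl_d _ _ h', Preadditive.add_comp, Category.assoc, Category.assoc,
      tensorInr_snd,
      tensorInl_snd, comp_zero, add_zero, Category.comp_id, Preadditive.comp_sub,
      ← Category.assoc, ← Category.assoc, tensorInl_snd, zero_comp, sub_zero, tensorInl_fst,
      localizationUnit_naturality_bimod]
  · rw [← Category.assoc, tensorInr_d _ _ _ h h', Preadditive.neg_comp, Category.assoc,
      tensorInr_snd,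
      Preadditive.comp_sub, ← Category.assoc, ← Category.assoc, tensorInr_snd, tensorInr_fst,
      zero_comp, zero_sub, Category.comp_id, Category.id_comp]

lemma fiberEquiv_snd (m m' n : ℤ) (h : m + 1 = n) (h' : m' + 1 = n) (x : M.X n)
    (z : (localizationTensor 𝕂 S M).X n) :
    fiberEquiv (complexLocalizationUnitApp 𝕂 S M) m n h (x, tensorSnd 𝕂 S M m n h z) =
      fiberEquiv (complexLocalizationUnitApp 𝕂 S M) m' n h' (x, tensorSnd 𝕂 S M m' n h' z) := by
  obtain rfl : m = m' := by omega
  rfl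

/-- The components of the isomorphism of `K(A;S) ⊗ M` with the fiber of `M ⟶ A_S ⊗ M`. -/
def tensorToFiberComponent (n : ℤ) :
    (localizationTensor 𝕂 S M).X n ⟶ (fiber (complexLocalizationUnitApp 𝕂 S M)).X n :=
  ModuleCat.ofHom
    ((fiberEquiv (complexLocalizationUnitApp 𝕂 S M) (n - 1) n (by omega)).toLinearMap ∘ₗ
      (((tensorFst 𝕂 S M).f n).hom.prod (tensorSnd 𝕂 S M (n - 1) n (by omega)).hom))

lemma tensorToFiberComponent_apply (m n : ℤ) (h : m + 1 = n)
    (z : (localizationTensor 𝕂 S M).X n) :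
    tensorToFiberComponent n z = fiberEquiv (complexLocalizationUnitApp 𝕂 S M) m n h
      ((tensorFst 𝕂 S M).f n z, tensorSnd 𝕂 S M m n h z) :=
  fiberEquiv_snd _ _ _ _ _ _ _

instance isIso_tensorToFiberComponent (n : ℤ) :
    IsIso (tensorToFiberComponent (𝕂 := 𝕂) (S := S) (M := M) n) := by
  let g : (fiber (complexLocalizationUnitApp 𝕂 S M)).X n ⟶ (localizationTensor 𝕂 S M).X n :=
    ModuleCat.ofHom (((inv ((tensorUnit 𝕂 A).app (M.X n)) ≫ tensorInl M n).hom.coprod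
      (tensorInr M (n - 1) n (by omega)).hom) ∘ₗ
      (fiberEquiv (complexLocalizationUnitApp 𝕂 S M) (n - 1) n (by omega)).symm.toLinearMap)
  have hg (x : M.X n) (y : (localizationFunctor 𝕂 S).obj (M.X (n - 1))) :
      g (fiberEquiv (complexLocalizationUnitApp 𝕂 S M) (n - 1) n (by omega) (x, y)) =
      tensorInl M n (inv ((tensorUnit 𝕂 A).app (M.X n)) x) + tensorInr M (n - 1) n (by omega) y :=
    congrArg ((inv ((tensorUnit 𝕂 A).app (M.X n)) ≫ tensorInl M n).hom.coprod
      (tensorInr M (n - 1) n (by omega)).hom) (LinearEquiv.symm_apply_apply _ (x, y))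
  refine ⟨g, ?_, ?_⟩
  · have : tensorToFiberComponent n ≫ g =
        (tensorFst 𝕂 S M).f n ≫ inv ((tensorUnit 𝕂 A).app (M.X n)) ≫ tensorInl M n +
        tensorSnd 𝕂 S M (n - 1) n (by omega) ≫ tensorInr M (n - 1) n (by omega) :=
      ModuleCat.hom_ext (LinearMap.ext fun z =>
        (congrArg g (tensorToFiberComponent_apply (n - 1) n (by omega) z)).trans (hg _ _))
    rw [this]
    refine localizationTensor_hom_ext' (show n - 1 + 1 = n by omega) ?_ ?_
    · rw [Preadditive.comp_add, ← Category.assoc, ← Category.assoc, tensorInl_fst,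
        ← Category.assoc (tensorInl M n)
        (tensorSnd 𝕂 S M (n - 1) n _), tensorInl_snd, zero_comp, add_zero,
        IsIso.hom_inv_id, Category.id_comp, Category.comp_id]
    · rw [Preadditive.comp_add, ← Category.assoc, ← Category.assoc, tensorInr_fst,
        ← Category.assoc (tensorInr M (n - 1) n _) (tensorSnd 𝕂 S M (n - 1) n _), tensorInr_snd,
        zero_comp, zero_comp, zero_add, Category.id_comp, Category.comp_id]
  · refine ModuleCat.hom_ext (LinearMap.ext fun z => ?_)
    obtain ⟨x, y, rfl⟩ := exists_eq_fiberEquiv _ (n - 1) n (by omega) z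
    change tensorToFiberComponent n (g _) = _
    refine (congrArg (tensorToFiberComponent n) (hg x y)).trans ?_
    refine (tensorToFiberComponent_apply (n - 1) n (by omega) _).trans ?_
    have e₁ (a : ((tensorBifunctor 𝕂 A).obj (regularBimod 𝕂 A)).obj (M.X n)) :
      (tensorFst 𝕂 S M).f n (tensorInl M n a) = (tensorUnit 𝕂 A).app (M.X n) a :=
        congrArg (fun f => f.hom a) (tensorInl_fst (S := S) (M := M) n)
    have e₂ (b : (localizationFunctor 𝕂 S).obj (M.X (n - 1))) :
      (tensorFst 𝕂 S M).f n (tensorInr M (n - 1) n (by omega) b) = 0 :=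
        congrArg (fun f => f.hom b) (tensorInr_fst (S := S) (M := M) (n - 1) n (by omega))
    have e₃ (a : ((tensorBifunctor 𝕂 A).obj (regularBimod 𝕂 A)).obj (M.X n)) :
      tensorSnd 𝕂 S M (n - 1) n (by omega) (tensorInl M n a) = 0 :=
        congrArg (fun f => f.hom a) (tensorInl_snd (S := S) (M := M) (n - 1) n (by omega))
    have e₄ (b : (localizationFunctor 𝕂 S).obj (M.X (n - 1))) :
      tensorSnd 𝕂 S M (n - 1) n (by omega) (tensorInr M (n - 1) n (by omega) b) = b :=
        congrArg (fun f => f.hom b) (tensorInr_snd (S := S) (M := M) (n - 1) n (by omega))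
    have e₅ : (tensorUnit 𝕂 A).app (M.X n) (inv ((tensorUnit 𝕂 A).app (M.X n)) x) = x :=
      congrArg (fun f => f.hom x) (IsIso.inv_hom_id ((tensorUnit 𝕂 A).app (M.X n)))
    refine congrArg (fiberEquiv (complexLocalizationUnitApp 𝕂 S M) (n - 1) n (by omega))
      (Prod.ext ?_ ?_)
    · refine (map_add ((tensorFst 𝕂 S M).f n).hom _ _).trans ?_
      exact (congrArg₂ (· + ·) ((e₁ _).trans e₅) (e₂ y)).trans (add_zero _)
    · refine (map_add (tensorSnd 𝕂 S M (n - 1) n (by omega)).hom _ _).trans ?_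
      exact (congrArg₂ (· + ·) (e₃ _) (e₄ y)).trans (zero_add _)

variable (𝕂 S M) in
/-- The canonical morphism from `K(A;S) ⊗ M` to the fiber of `M ⟶ A_S ⊗ M`. -/
def tensorToFiber : localizationTensor 𝕂 S M ⟶ fiber (complexLocalizationUnitApp 𝕂 S M) where
  f n := tensorToFiberComponent n
  comm' i j hij' := by
    have hij : i + 1 = j := hij'
    refine ModuleCat.hom_ext (LinearMap.ext fun z => ?_)
    change (fiber (complexLocalizationUnitApp 𝕂 S M)).d i j (tensorToFiberComponent i z) =
      tensorToFiberComponent j ((localizationTensor 𝕂 S M).d i j z)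
    rw [tensorToFiberComponent_apply (i - 1) i (by omega), tensorToFiberComponent_apply i j hij]
    refine (fiber_d _ (i - 1) i j (by omega) hij _ _).trans ?_
    exact congrArg (fiberEquiv (complexLocalizationUnitApp 𝕂 S M) i j hij)
      (Prod.ext (hom_d_apply (tensorFst 𝕂 S M) i j z).symm
        (congrArg (fun f => f.hom z) (tensorSnd_d (i - 1) i j (by omega) hij)).symm)

lemma tensorToFiber_fst :
    tensorToFiber 𝕂 S M ≫ fiberFst (complexLocalizationUnitApp 𝕂 S M) = tensorFst 𝕂 S M := by
  ext n : 1
  refine ModuleCat.hom_ext (LinearMap.ext fun z => ?_)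
  rfl

variable (𝕂 S M) in
instance isIso_tensorToFiber : IsIso (tensorToFiber 𝕂 S M) := by
  have (n : ℤ) : IsIso ((tensorToFiber 𝕂 S M).f n) := isIso_tensorToFiberComponent n
  exact HomologicalComplex.Hom.isIso_of_components _

variable {M' : CochainComplex (ModuleCat.{u} A) ℤ} (g : M ⟶ M')

lemma tensorInl_map (n : ℤ) : tensorInl (S := S) M n ≫ (HomologicalComplex.mapBifunctorMap
      (𝟙 (localizationComplex 𝕂 S)) g (tensorBifunctor 𝕂 A) (ComplexShape.up ℤ)).f n =
    ((tensorBifunctor 𝕂 A).obj (regularBimod 𝕂 A)).map (g.f n) ≫ tensorInl M' n := by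
  rw [tensorInl, tensorInl, Category.assoc, HomologicalComplex.ι_mapBifunctorMap]
  simp

lemma tensorInr_map (m n : ℤ) (h : m + 1 = n) :
    tensorInr (S := S) M m n h ≫ (HomologicalComplex.mapBifunctorMap
      (𝟙 (localizationComplex 𝕂 S)) g (tensorBifunctor 𝕂 A) (ComplexShape.up ℤ)).f n =
    (localizationFunctor 𝕂 S).map (g.f m) ≫ tensorInr M' m n h := by
  rw [tensorInr, tensorInr, Category.assoc, HomologicalComplex.ι_mapBifunctorMap]
  simp

lemma tensorSnd_naturality (m n : ℤ) (h : m + 1 = n) :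
    (HomologicalComplex.mapBifunctorMap
      (𝟙 (localizationComplex 𝕂 S)) g (tensorBifunctor 𝕂 A) (ComplexShape.up ℤ)).f n ≫
        tensorSnd 𝕂 S M' m n h =
      tensorSnd 𝕂 S M m n h ≫ (localizationFunctor 𝕂 S).map (g.f m) := by
  refine localizationTensor_hom_ext' h ?_ ?_
  · rw [← Category.assoc, ← Category.assoc, tensorInl_map, tensorInl_snd, zero_comp, Category.assoc,
      tensorInl_snd, comp_zero]
  · rw [← Category.assoc, ← Category.assoc, tensorInr_map, tensorInr_snd, Category.id_comp,
      Category.assoc, tensorInr_snd, Category.comp_id]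

lemma tensorFst_naturality :
    HomologicalComplex.mapBifunctorMap
      (𝟙 (localizationComplex 𝕂 S)) g (tensorBifunctor 𝕂 A) (ComplexShape.up ℤ) ≫
        tensorFst 𝕂 S M' = tensorFst 𝕂 S M ≫ g :=
  (complexTensorMap (localizationComplexToRegular 𝕂 S) ≫ complexTensorUnit 𝕂 A).naturality g

variable (𝕂 S) in
/-- The complex `K(A;S) ⊗ M` is naturally isomorphic to the fiber of `M ⟶ A_S ⊗ M`. -/
def tensorIsoFiber : complexTensor (localizationComplex 𝕂 S) ≅ localizationFiber 𝕂 S :=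
  NatIso.ofComponents (fun M => @asIso _ _ _ _ (tensorToFiber 𝕂 S M) (isIso_tensorToFiber 𝕂 S M))
    fun {M M'} g => by
    ext n : 1
    refine ModuleCat.hom_ext (LinearMap.ext fun z => ?_)
    refine (tensorToFiberComponent_apply (n - 1) n (by omega) _).trans ?_
    refine Eq.trans ?_ (congrArg ((fiberMap g ((complexLocalization 𝕂 S).map g)
      (complexLocalizationUnitApp_naturality 𝕂 S g).symm).f n)
      (tensorToFiberComponent_apply (n - 1) n (by omega) z)).symm
    refine Eq.trans ?_ (fiberMap_apply _ _ _ _ _ _ _ _).symm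
    exact congrArg (fiberEquiv (complexLocalizationUnitApp 𝕂 S M') (n - 1) n (by omega))
      (Prod.ext (congrArg (fun f => (f.f n).hom z) (tensorFst_naturality g))
        (congrArg (fun f => f.hom z) (tensorSnd_naturality g (n - 1) n (by omega))))

lemma tensorIsoFiber_hom_app_fst :
    (tensorIsoFiber 𝕂 S).hom.app M ≫ fiberFst (complexLocalizationUnitApp 𝕂 S M) =
      (complexTensorMap (localizationComplexToRegular 𝕂 S) ≫ complexTensorUnit 𝕂 A).app M :=
  tensorToFiber_fst

variable (𝕂 S) in
lemma quasiIso_localizationFiber_map (hg : QuasiIso g) :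
    QuasiIso ((localizationFiber 𝕂 S).map g) :=
  quasiIso_fiberMap g ((complexLocalization 𝕂 S).map g)
    (complexLocalizationUnitApp_naturality 𝕂 S g).symm hg inferInstance

variable (𝕂 S) in
-- Exactness of localisation makes the fiber, hence `K(A;S) ⊗ (-)`, respect quasi-isomorphisms. The
-- derived tensor product with `K(A;S)` is therefore computed without resolutions.
lemma quasiIso_complexTensor_map (hg : QuasiIso g) :
    QuasiIso ((complexTensor (localizationComplex 𝕂 S)).map g) := by
  have := quasiIso_localizationFiber_map 𝕂 S g hg
  have h := (tensorIsoFiber 𝕂 S).hom.naturality g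
  have : QuasiIso ((complexTensor (localizationComplex 𝕂 S)).map g ≫
      (tensorIsoFiber 𝕂 S).hom.app M') := by
    rw [h]
    infer_instance
  exact quasiIso_of_comp_right _ ((tensorIsoFiber 𝕂 S).hom.app M')

end LocalizationTensor

/-! ### A functorial embedding of modules into injective modules. -/

section DualPower

variable {A : Type u} [Ring A]

/-- The functor sending a module `M` to the product of copies of `G` indexed by the homomorphisms
from `M` to `G`. -/
def dualPower (G : ModuleCat.{u} A) : ModuleCat.{u} A ⥤ ModuleCat.{u} A where
  obj M := ModuleCat.of A ((M ⟶ G) → G)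
  map f := ModuleCat.ofHom (LinearMap.funLeft A G fun h => f ≫ h)

/-- The evaluation map from a module `M` to the product of copies of `G` indexed by the
homomorphisms from `M` to `G`. -/
def dualPowerUnit (G : ModuleCat.{u} A) : 𝟭 (ModuleCat.{u} A) ⟶ dualPower G where
  app M := ModuleCat.ofHom (LinearMap.pi fun h => h.hom)

/-- The projection of a product of copies of `G` to one of the factors. -/
def dualPowerProj (G M : ModuleCat.{u} A) (h : M ⟶ G) : (dualPower G).obj M ⟶ G :=
  ModuleCat.ofHom (LinearMap.proj h)

lemma dualPowerUnit_proj (G M : ModuleCat.{u} A) (h : M ⟶ G) :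
    (dualPowerUnit G).app M ≫ dualPowerProj G M h = h := rfl

instance injective_dualPower_obj (G M : ModuleCat.{u} A) [Injective G] :
    Injective ((dualPower G).obj M) where
  factors {X Y} g f _ :=
    ⟨ModuleCat.ofHom (LinearMap.pi fun h =>
      (Injective.factorThru (g ≫ dualPowerProj G M h) f).hom), by
      ext x
      refine funext fun h => ?_
      exact congrArg (fun k => k.hom x) (Injective.comp_factorThru (g ≫ dualPowerProj G M h) f)⟩

/-- A nonzero element is a nonzero morphism `A → M`, which some homomorphism `M → G` detects. -/
lemma dualPowerUnit_injective {G : ModuleCat.{u} A} (hG : IsCoseparator G) (M : ModuleCat.{u} A) :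
    Function.Injective ((dualPowerUnit G).app M) := by
  refine (injective_iff_map_eq_zero ((dualPowerUnit G).app M).hom).2 fun m hm => ?_
  have h : ModuleCat.ofHom (LinearMap.toSpanSingleton A M m) = 0 := by
    refine (isCoseparator_def G).1 hG _ _ fun h => ?_
    ext
    have h₁ : h m = 0 := congrFun hm h
    have h₂ : h.hom ((1 : A) • m) = 0 := by rw [one_smul]; exact h₁
    simpa using h₁
  simpa using congrArg (fun f => f.hom (1 : A)) h

variable (A) in
lemma exists_injective_coseparator : ∃ G : ModuleCat.{u} A, Injective G ∧ IsCoseparator G :=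
  Abelian.has_injective_coseparator _ (ModuleCat.isSeparator.{u} A)

end DualPower

/-! ### A functorial resolution of unbounded complexes. -/

section Resolution

variable {A : Type u} [Ring A] (G : ModuleCat.{u} A)

/-- The cone of the identity of the graded module `n ↦ E(M^n)`, where `E(M^n)` is the product of
copies of `G` indexed by the homomorphisms from `M^n` to `G`. -/
def dualPowerCone (M : CochainComplex (ModuleCat.{u} A) ℤ) :
    CochainComplex (ModuleCat.{u} A) ℤ where
  X n := ModuleCat.of A ((dualPower G).obj (M.X n) × (dualPower G).obj (M.X (n + 1)))
  d i j := ModuleCat.ofHom <|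
    if h : i + 1 = j then
      LinearMap.inl A _ _ ∘ₗ ((dualPower G).map (M.XIsoOfEq h).hom).hom ∘ₗ LinearMap.snd A _ _
    else 0
  shape i j h := by
    have h' : ¬ i + 1 = j := h
    rw [dif_neg h']
    rfl
  d_comp_d' i j k hij hjk := by
    obtain rfl : i + 1 = j := hij
    obtain rfl : i + 1 + 1 = k := hjk
    rw [dif_pos rfl, dif_pos rfl]
    refine ModuleCat.hom_ext (LinearMap.ext fun x => ?_)
    exact Prod.ext (map_zero ((dualPower G).map (M.XIsoOfEq rfl).hom).hom) rfl

/-- `dualPower` is not additive, so applying it to the differentials of `M` would not give a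
complex. Here the differential only shifts a coordinate and does not involve that of `M`, which
enters through `toDualPowerCone` instead. -/
lemma dualPowerCone_d (M : CochainComplex (ModuleCat.{u} A) ℤ) (i : ℤ)
    (x : (dualPower G).obj (M.X i) × (dualPower G).obj (M.X (i + 1))) :
    (dualPowerCone G M).d i (i + 1) x = (x.2, 0) := by
  have h : (dualPowerCone G M).d i (i + 1) = ModuleCat.ofHom
    (LinearMap.inl A _ _ ∘ₗ ((dualPower G).map (M.XIsoOfEq rfl).hom).hom ∘ₗ LinearMap.snd A _ _) :=
      congrArg ModuleCat.ofHom (dif_pos rfl)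
  rw [h]
  refine Prod.ext ?_ rfl
  exact congrArg (fun f => f.hom x.2) ((dualPower G).map_id _)

/-- The functor `dualPowerCone`. -/
def dualPowerConeFunctor :
    CochainComplex (ModuleCat.{u} A) ℤ ⥤ CochainComplex (ModuleCat.{u} A) ℤ where
  obj := dualPowerCone G
  map {M N} f :=
    { f n := ModuleCat.ofHom
        (((dualPower G).map (f.f n)).hom.prodMap ((dualPower G).map (f.f (n + 1))).hom)
      comm' i j hij := by
        obtain rfl : i + 1 = j := hij
        refine ModuleCat.hom_ext (LinearMap.ext fun x => ?_)
        refine (dualPowerCone_d G N i _).trans ?_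
        refine Eq.trans ?_ (congrArg (Prod.map ((dualPower G).map (f.f (i + 1))).hom
          ((dualPower G).map (f.f (i + 1 + 1))).hom) (dualPowerCone_d G M i x)).symm
        exact Prod.ext rfl (map_zero ((dualPower G).map (f.f (i + 1 + 1))).hom).symm }

/-- The natural morphism from a complex to the corresponding complex `dualPowerCone`. -/
def toDualPowerCone : 𝟭 (CochainComplex (ModuleCat.{u} A) ℤ) ⟶ dualPowerConeFunctor G where
  app M :=
    { f n := ModuleCat.ofHom (((dualPowerUnit G).app (M.X n)).hom.prod
        (M.d n (n + 1) ≫ (dualPowerUnit G).app (M.X (n + 1))).hom)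
      comm' i j hij := by
        obtain rfl : i + 1 = j := hij
        refine ModuleCat.hom_ext (LinearMap.ext fun x => ?_)
        refine (dualPowerCone_d G M i _).trans ?_
        refine Prod.ext rfl ?_
        refine ((congrArg ((dualPowerUnit G).app (M.X (i + 1 + 1)))
          (d_d_apply (K := M) i (i + 1) (i + 1 + 1) x)).trans
          (map_zero _)).symm }
  naturality M N f := by
    ext n : 1
    refine ModuleCat.hom_ext (LinearMap.ext fun x => Prod.ext ?_ ?_)
    · rfl
    · exact congrArg ((dualPowerUnit G).app (N.X (n + 1))) (hom_d_apply f n (n + 1) x).symm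

lemma toDualPowerCone_injective (hG : IsCoseparator G) (M : CochainComplex (ModuleCat.{u} A) ℤ)
    (n : ℤ) : Function.Injective (((toDualPowerCone G).app M).f n) := fun _ _ h =>
  dualPowerUnit_injective hG _ (congrArg Prod.fst h)

/-- The cokernel of `toDualPowerCone`. -/
abbrev dualPowerCoker :
    CochainComplex (ModuleCat.{u} A) ℤ ⥤ CochainComplex (ModuleCat.{u} A) ℤ :=
  cokernel (toDualPowerCone G)

/-- The projection to the cokernel of `toDualPowerCone`. -/
abbrev dualPowerCokerProj : dualPowerConeFunctor G ⟶ dualPowerCoker G :=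
  cokernel.π (toDualPowerCone G)

lemma dualPowerCokerProj_surjective (M : CochainComplex (ModuleCat.{u} A) ℤ) (n : ℤ) :
    Function.Surjective (((dualPowerCokerProj G).app M).f n) := by
  rw [← ModuleCat.epi_iff_surjective]
  infer_instance

lemma dualPowerCokerProj_exact (M : CochainComplex (ModuleCat.{u} A) ℤ) (n : ℤ)
    (x : ((dualPowerConeFunctor G).obj M).X n) (hx : ((dualPowerCokerProj G).app M).f n x = 0) :
    ∃ z, ((toDualPowerCone G).app M).f n z = x := by
  have h := (ShortComplex.exact_cokernel (toDualPowerCone G)).map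
    ((evaluation _ _).obj M ⋙ HomologicalComplex.eval (ModuleCat.{u} A) (ComplexShape.up ℤ) n)
  rw [ShortComplex.moduleCat_exact_iff] at h
  exact h x hx

/-- A functorial resolution of complexes by complexes whose terms are extensions of products of
copies of `G` and quotients of such. -/
def dualPowerResolution :
    CochainComplex (ModuleCat.{u} A) ℤ ⥤ CochainComplex (ModuleCat.{u} A) ℤ :=
  fiberFunctor (dualPowerCokerProj G)

/-- The canonical morphism from a complex to its resolution. -/
def toDualPowerResolution :
    𝟭 (CochainComplex (ModuleCat.{u} A) ℤ) ⟶ dualPowerResolution G where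
  app M := fiberLift (φ := (dualPowerCokerProj G).app M) ((toDualPowerCone G).app M)
    (congrArg (fun τ => τ.app M) (cokernel.condition (toDualPowerCone G)))
  naturality M N f := by
    ext n : 1
    refine ModuleCat.hom_ext (LinearMap.ext fun x => Prod.ext ?_ ?_)
    · exact congrArg (fun g => (g.f n).hom x) ((toDualPowerCone G).naturality f)
    · exact (map_zero (((dualPowerCoker G).map f).f (n - 1)).hom).symm

lemma quasiIso_toDualPowerResolution (hG : IsCoseparator G)
    (M : CochainComplex (ModuleCat.{u} A) ℤ) : QuasiIso ((toDualPowerResolution G).app M) :=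
  quasiIso_fiberLift _ (congrArg (fun τ => τ.app M) (cokernel.condition (toDualPowerCone G)))
    (toDualPowerCone_injective G hG M) (dualPowerCokerProj_exact G M)
    (dualPowerCokerProj_surjective G M)

/-- Each term is a product of two injective modules and a quotient of such a product. The quotient
need not be injective, but it inherits a surjective localisation map; hence the resolution can stop
after one step, with no boundedness condition. -/
lemma toLocalization_surjective_dualPowerResolution (S : Submonoid A) [OreLocalization.OreSet S]
    [Injective G]
    (h : ∀ E : ModuleCat.{u} A, Injective E → Function.Surjective (toLocalization S E))
    (M : CochainComplex (ModuleCat.{u} A) ℤ) (n : ℤ) :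
    Function.Surjective (toLocalization S (((dualPowerResolution G).obj M).X n)) := by
  have h₁ (n : ℤ) : Function.Surjective (toLocalization S ((dualPowerCone G M).X n)) :=
    toLocalization_surjective_prod (h _ inferInstance) (h _ inferInstance)
  exact toLocalization_surjective_prod (h₁ n) (toLocalization_surjective_of_surjective
    (((dualPowerCokerProj G).app M).f (n - 1)).hom (dualPowerCokerProj_surjective G M (n - 1))
    (h₁ (n - 1)))

end Resolution

/-! ### Recognising a right derived functor from a functorial resolution. -/

section RightDerivedFunctors

variable {C D H : Type*} [Category* C] [Category* D] [Category* H]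

/-- A functor `RF` is a right derived functor of `F` as soon as there is a functorial resolution by
objects on which `F` and `RF` agree. -/
lemma isRightDerivedFunctor_of_resolution {L : C ⥤ D} (W : MorphismProperty C)
    [L.IsLocalization W] {F : C ⥤ H} {RF : D ⥤ H} (α : F ⟶ L ⋙ RF) {X : C ⥤ C} (ρ : 𝟭 C ⟶ X)
    (hρ : ∀ M, W (ρ.app M)) (hα : ∀ M, IsIso (α.app (X.obj M))) :
    RF.IsRightDerivedFunctor α W := by
  have hL (M : C) : IsIso (L.map (ρ.app M)) := Localization.inverts L W _ (hρ M)
  -- As `L` inverts `ρ`, a transformation is determined by its values on resolved objects. There, a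
  -- factorisation of `β` through the invertible `α` must be `α⁻¹ ≫ β`, which dictates the formula
  -- for `τ` and gives uniqueness.
  have key (G : D ⥤ H) (γ : L ⋙ RF ⟶ L ⋙ G) (M : C) : γ.app M =
      RF.map (L.map (ρ.app M)) ≫ γ.app (X.obj M) ≫ inv (G.map (L.map (ρ.app M))) := by
    rw [← Category.assoc, IsIso.eq_comp_inv]
    exact (γ.naturality (ρ.app M)).symm
  let τ (G : D ⥤ H) (β : F ⟶ L ⋙ G) : L ⋙ RF ⟶ L ⋙ G :=
    { app M := RF.map (L.map (ρ.app M)) ≫ inv (α.app (X.obj M)) ≫ β.app (X.obj M) ≫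
        inv (G.map (L.map (ρ.app M)))
      naturality M N f := by
        have h : f ≫ ρ.app N = ρ.app M ≫ X.map f := ρ.naturality f
        have h₁ : RF.map (L.map f) ≫ RF.map (L.map (ρ.app N)) =
          RF.map (L.map (ρ.app M)) ≫ RF.map (L.map (X.map f)) := by
            simp only [← Functor.map_comp, h]
        have h₂ : inv (G.map (L.map (ρ.app M))) ≫ G.map (L.map f) =
          G.map (L.map (X.map f)) ≫ inv (G.map (L.map (ρ.app N))) := by
            rw [IsIso.inv_comp_eq, ← Category.assoc, IsIso.eq_comp_inv]
            simp only [← Functor.map_comp, h]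
        have h₃ : RF.map (L.map (X.map f)) ≫ inv (α.app (X.obj N)) =
          inv (α.app (X.obj M)) ≫ F.map (X.map f) := by
            rw [IsIso.comp_inv_eq, Category.assoc, IsIso.eq_inv_comp]
            exact (α.naturality (X.map f)).symm
        have h₄ : F.map (X.map f) ≫ β.app (X.obj N) =
          β.app (X.obj M) ≫ G.map (L.map (X.map f)) := β.naturality (X.map f)
        simp only [Functor.comp_map, Category.assoc]
        rw [← Category.assoc, h₁, Category.assoc, ← Category.assoc (RF.map (L.map (X.map f))), h₃,
          Category.assoc, ← Category.assoc (F.map (X.map f)), h₄, Category.assoc, h₂] }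
  let δ (G : D ⥤ H) (β : F ⟶ L ⋙ G) : RF ⟶ G :=
    Localization.liftNatTrans L W (L ⋙ RF) (L ⋙ G) RF G (τ G β)
  have hδ (G : D ⥤ H) (β : F ⟶ L ⋙ G) (M : C) : (δ G β).app (L.obj M) = (τ G β).app M := by
    refine (Localization.liftNatTrans_app L W _ _ _ _ _ M).trans ?_
    exact (Category.id_comp _).trans (Category.comp_id _)
  refine ⟨⟨⟨IsInitial.ofUniqueHom (fun E => StructuredArrow.homMk (δ E.right E.hom) ?_) ?_⟩⟩⟩
  · ext M
    refine (congrArg (α.app M ≫ ·) (hδ E.right E.hom M)).trans ?_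
    have h : α.app M ≫ RF.map (L.map (ρ.app M)) = F.map (ρ.app M) ≫ α.app (X.obj M) :=
      (α.naturality (ρ.app M)).symm
    have h' : F.map (ρ.app M) ≫ E.hom.app (X.obj M) = E.hom.app M ≫ E.right.map (L.map (ρ.app M)) :=
      E.hom.naturality (ρ.app M)
    dsimp only [τ]
    rw [← Category.assoc, h, Category.assoc, IsIso.hom_inv_id_assoc, ← Category.assoc, h',
      Category.assoc, IsIso.hom_inv_id, Category.comp_id]
  · intro E m
    let μ : RF ⟶ E.right := m.right
    refine StructuredArrow.hom_ext _ _ (Localization.natTrans_ext L W fun M => ?_)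
    refine Eq.trans ?_ (hδ E.right E.hom M).symm
    refine (key E.right (Functor.whiskerLeft L μ) M).trans ?_
    have h : α.app (X.obj M) ≫ μ.app (L.obj (X.obj M)) = E.hom.app (X.obj M) :=
      congrArg (fun τ => τ.app (X.obj M)) (StructuredArrow.w m)
    dsimp only [τ]
    rw [← h]
    simp only [Functor.whiskerLeft_app, Category.assoc, IsIso.inv_hom_id_assoc]

end RightDerivedFunctors

/-! ### The comparison of `Γ_S M` with `K(A;S) ⊗ M`. -/

section TorsionToFiber

variable (𝕂 : Type v) [CommRing 𝕂] {A : Type u} [Ring A] [Algebra 𝕂 A]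
  (S : Submonoid A) [OreLocalization.OreSet S]

/-- The inclusion `Γ_S M ⟶ M` for complexes. -/
def complexTorsionInclusion :
    (oreTorsionFunctor S).mapHomologicalComplex (ComplexShape.up ℤ) ⟶
      𝟭 (CochainComplex (ModuleCat.{u} A) ℤ) :=
  NatTrans.mapHomologicalComplex (torsionInclusion (oreTorsionClass S)) (ComplexShape.up ℤ) ≫
    (Functor.mapHomologicalComplexIdIso (ModuleCat.{u} A) (ComplexShape.up ℤ)).hom

lemma complexTorsionInclusion_comp (M : CochainComplex (ModuleCat.{u} A) ℤ) :
    (complexTorsionInclusion S).app M ≫ complexLocalizationUnitApp 𝕂 S M = 0 := by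
  ext n : 1
  refine ModuleCat.hom_ext (LinearMap.ext fun x => ?_)
  exact (localizationUnit_app_eq_zero_iff _).2 ((mem_torsionSubmodule_iff S _ _).1 x.2)

/-- The canonical morphism from `Γ_S M` to the fiber of `M ⟶ A_S ⊗ M`. -/
def torsionToFiber :
    (oreTorsionFunctor S).mapHomologicalComplex (ComplexShape.up ℤ) ⟶ localizationFiber 𝕂 S where
  app M := fiberLift (φ := complexLocalizationUnitApp 𝕂 S M) ((complexTorsionInclusion S).app M)
    (complexTorsionInclusion_comp 𝕂 S M)
  naturality M N f := by
    ext n : 1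
    refine ModuleCat.hom_ext (LinearMap.ext fun x => Prod.ext ?_ ?_)
    · exact congrArg (fun g => (g.f n).hom x) ((complexTorsionInclusion S).naturality f)
    · exact (map_zero (((complexLocalization 𝕂 S).map f).f (n - 1)).hom).symm

/-- The hypothesis makes `0 → Γ_S M → M → A_S ⊗ M → 0` exact in each degree, so `Γ_S M` is the
homotopy fiber. -/
lemma quasiIso_torsionToFiber_app (M : CochainComplex (ModuleCat.{u} A) ℤ)
    (h : ∀ n, Function.Surjective (toLocalization S (M.X n))) :
    QuasiIso ((torsionToFiber 𝕂 S).app M) :=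
  quasiIso_fiberLift _ (complexTorsionInclusion_comp 𝕂 S M)
    (fun _ => Subtype.val_injective)
    (fun _ x hx => ⟨⟨x, (mem_torsionSubmodule_iff S _ _).2
      ((localizationUnit_app_eq_zero_iff x).1 hx)⟩, rfl⟩)
    (fun n => (localizationUnit_app_surjective_iff (M.X n)).2 (h n))

/-- The canonical morphism from `Γ_S M` to `K(A;S) ⊗ M`. -/
def torsionToTensor :
    (oreTorsionFunctor S).mapHomologicalComplex (ComplexShape.up ℤ) ⟶
      complexTensor (localizationComplex 𝕂 S) :=
  torsionToFiber 𝕂 S ≫ (tensorIsoFiber 𝕂 S).inv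

lemma torsionToTensor_comp (M : CochainComplex (ModuleCat.{u} A) ℤ) :
    (torsionToTensor 𝕂 S).app M ≫
      (complexTensorMap (localizationComplexToRegular 𝕂 S) ≫ complexTensorUnit 𝕂 A).app M =
    (complexTorsionInclusion S).app M := by
  have h : (torsionToTensor 𝕂 S).app M ≫ (tensorIsoFiber 𝕂 S).hom.app M =
      (torsionToFiber 𝕂 S).app M := by
    rw [torsionToTensor, NatTrans.comp_app, Category.assoc, Iso.inv_hom_id_app, Category.comp_id]
  rw [← tensorIsoFiber_hom_app_fst]
  refine (Category.assoc _ _ _).symm.trans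
    ((congrArg (· ≫ fiberFst (complexLocalizationUnitApp 𝕂 S M)) h).trans ?_)
  exact fiberLift_fst (φ := complexLocalizationUnitApp 𝕂 S M) _
    (complexTorsionInclusion_comp 𝕂 S M)

end TorsionToFiber

/-! ### The implication (iii) → (iv). -/

section DerivedIso

variable (𝕂 : Type v) [CommRing 𝕂] {A : Type u} [Ring A] [Algebra 𝕂 A]
  [HasDerivedCategory.{w} (ModuleCat.{u} A)] (S : Submonoid A) [OreLocalization.OreSet S]

lemma isInvertedBy_complexTensor :
    (HomologicalComplex.quasiIso (ModuleCat.{u} A) (ComplexShape.up ℤ)).IsInvertedBy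
      (complexTensor (localizationComplex 𝕂 S) ⋙ DerivedCategory.Q) := fun _ _ f hf => by
  have := quasiIso_complexTensor_map 𝕂 S f hf
  exact Localization.inverts DerivedCategory.Q
    (HomologicalComplex.quasiIso (ModuleCat.{u} A) (ComplexShape.up ℤ)) _ this

/-- The functor `K(A;S) ⊗ (-)`, which preserves quasi-isomorphisms, as a functor on the derived
category. -/
def derivedLocalizationTensor :
    DerivedCategory (ModuleCat.{u} A) ⥤ DerivedCategory (ModuleCat.{u} A) :=
  Localization.lift (complexTensor (localizationComplex 𝕂 S) ⋙ DerivedCategory.Q)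
    (isInvertedBy_complexTensor 𝕂 S) DerivedCategory.Q

/-- The functor `derivedLocalizationTensor` is induced by `K(A;S) ⊗ (-)`. -/
def derivedLocalizationTensorIso :
    DerivedCategory.Q ⋙ derivedLocalizationTensor 𝕂 S ≅
      complexTensor (localizationComplex 𝕂 S) ⋙ DerivedCategory.Q :=
  Localization.fac (complexTensor (localizationComplex 𝕂 S) ⋙ DerivedCategory.Q)
    (isInvertedBy_complexTensor 𝕂 S) DerivedCategory.Q

/-- The derived tensor product with `K(A;S)`. -/
def derivedTensorModel : DerivedTensor.{w} (localizationComplex 𝕂 S) where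
  functor := derivedLocalizationTensor 𝕂 S
  counit := (derivedLocalizationTensorIso 𝕂 S).hom
  isLeftDerived :=
    letI : Localization.Lifting DerivedCategory.Q
      (HomologicalComplex.quasiIso (ModuleCat.{u} A) (ComplexShape.up ℤ))
      (complexTensor (localizationComplex 𝕂 S) ⋙ DerivedCategory.Q)
      (derivedLocalizationTensor 𝕂 S) := ⟨derivedLocalizationTensorIso 𝕂 S⟩
    Functor.isLeftDerivedFunctor_of_inverts _ _ _

/-- If `E ⟶ E_S` is surjective for all injective modules `E`, then the derived tensor product with
`K(A;S)` is a right derived functor of `Γ_S`. -/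
def derivedTorsionModel
    (h : ∀ E : ModuleCat.{u} A, Injective E → Function.Surjective (toLocalization S E)) :
    RightDerived.{w} (oreTorsionFunctor S) where
  functor := derivedLocalizationTensor 𝕂 S
  unit := Functor.whiskerRight (torsionToTensor 𝕂 S) DerivedCategory.Q ≫
    (derivedLocalizationTensorIso 𝕂 S).inv
  isRightDerived := by
    obtain ⟨G, hG, hG'⟩ := exists_injective_coseparator A
    refine isRightDerivedFunctor_of_resolution _ _ (toDualPowerResolution G)
      (quasiIso_toDualPowerResolution G hG') fun M => ?_
    have h₁ := quasiIso_torsionToFiber_app 𝕂 S ((dualPowerResolution G).obj M)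
      (toLocalization_surjective_dualPowerResolution G S h M)
    have h₂ : QuasiIso ((torsionToTensor 𝕂 S).app ((dualPowerResolution G).obj M)) := by
      dsimp only [torsionToTensor, NatTrans.comp_app]
      infer_instance
    have h₃ : IsIso (DerivedCategory.Q.map
      ((torsionToTensor 𝕂 S).app ((dualPowerResolution G).obj M))) :=
      Localization.inverts DerivedCategory.Q
        (HomologicalComplex.quasiIso (ModuleCat.{u} A) (ComplexShape.up ℤ)) _ h₂
    dsimp only [NatTrans.comp_app, Functor.whiskerRight_app]
    infer_instance

/-- One functor serves as a model both of `RΓ_S` and of the derived tensor product, so `ν` is the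
identity. By the universal property, compatibility with the maps to the identity functor need only
be checked on complexes, where it is `torsionToTensor_comp`. -/
lemma derivedTorsionIsTensor_of_surjective
    (h : ∀ E : ModuleCat.{u} A, Injective E → Function.Surjective (toLocalization S E)) :
    DerivedTorsionIsTensor.{w} 𝕂 S := by
  refine ⟨derivedTorsionModel 𝕂 S h, derivedTensorModel 𝕂 S, 𝟙 (derivedLocalizationTensor 𝕂 S), ?_,
    inferInstanceAs (IsIso (𝟙 (derivedLocalizationTensor 𝕂 S)))⟩
  refine (derivedTorsionModel 𝕂 S h).functor.rightDerived_ext (derivedTorsionModel 𝕂 S h).unit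
    (HomologicalComplex.quasiIso (ModuleCat.{u} A) (ComplexShape.up ℤ)) _ _ _ ?_
  refine Eq.trans ?_ (Functor.rightDerived_fac _ _ _ _ _).symm
  ext M : 2
  have h₁ := Functor.leftDerivedNatTrans_app (derivedTensorModel 𝕂 S).functor (𝟭 _)
    (derivedTensorModel 𝕂 S).counit (DerivedCategory.Q (C := ModuleCat.{u} A)).rightUnitor.hom
    (HomologicalComplex.quasiIso (ModuleCat.{u} A) (ComplexShape.up ℤ))
    (Functor.whiskerRight (complexTensorMap (localizationComplexToRegular 𝕂 S) ≫
      complexTensorUnit 𝕂 A) DerivedCategory.Q ≫ (Functor.leftUnitor _).hom) M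
  have h₂ : (derivedTensorToId (localizationComplexToRegular 𝕂 S) (derivedTensorModel 𝕂 S)).app
      (DerivedCategory.Q.obj M) = (derivedLocalizationTensorIso 𝕂 S).hom.app M ≫
      DerivedCategory.Q.map ((complexTensorMap (localizationComplexToRegular 𝕂 S) ≫
        complexTensorUnit 𝕂 A).app M) :=
    (Category.comp_id _).symm.trans (h₁.trans (congrArg (_ ≫ ·) (Category.comp_id _)))
  have h₃ : (DerivedCategory.Q.map ((torsionToTensor 𝕂 S).app M) ≫
      (derivedLocalizationTensorIso 𝕂 S).inv.app M) ≫
      (derivedTensorToId (localizationComplexToRegular 𝕂 S) (derivedTensorModel 𝕂 S)).app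
      (DerivedCategory.Q.obj M) = DerivedCategory.Q.map ((complexTorsionInclusion S).app M) := by
    rw [h₂, Category.assoc, Iso.inv_hom_id_app_assoc, ← Functor.map_comp, torsionToTensor_comp]
  refine (congrArg (_ ≫ ·) (Category.id_comp _)).trans (h₃.trans ?_)
  exact ((congrArg (_ ≫ ·) (Category.comp_id _)).trans (Category.comp_id _)).symm

end DerivedIso

/-! ### Modules as complexes in degree zero. -/

section Single

variable {A : Type u} [Ring A]

/-- A module as a complex in degree zero. -/
abbrev singleZero : ModuleCat.{u} A ⥤ CochainComplex (ModuleCat.{u} A) ℤ :=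
  HomologicalComplex.single (ModuleCat.{u} A) (ComplexShape.up ℤ) 0

lemma singleObjXSelf_inv_map {X Y : ModuleCat.{u} A} (f : X ⟶ Y) :
    (HomologicalComplex.singleObjXSelf (ComplexShape.up ℤ) 0 X).inv ≫ (singleZero.map f).f 0 =
      f ≫ (HomologicalComplex.singleObjXSelf (ComplexShape.up ℤ) 0 Y).inv := by
  rw [HomologicalComplex.single_map_f_self, Iso.inv_hom_id_assoc]

end Single

/-! ### Morphisms in `D(A)` to an injective module in degree zero. -/

section ToSingle

variable {A : Type u} [Ring A] [HasDerivedCategory.{w} (ModuleCat.{u} A)]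

/-- The homology of a complex is the homology of its image in the derived category. -/
def homologyIsoQ (M : CochainComplex (ModuleCat.{u} A) ℤ) (n : ℤ) :
    M.homology n ≅ (DerivedCategory.homologyFunctor (ModuleCat.{u} A) n).obj
      (DerivedCategory.Q.obj M) :=
  ((DerivedCategory.homologyFunctorFactors (ModuleCat.{u} A) n).app M).symm

lemma homologyIsoQ_naturality {M N : CochainComplex (ModuleCat.{u} A) ℤ} (g : M ⟶ N) (n : ℤ) :
    HomologicalComplex.homologyMap g n ≫ (homologyIsoQ N n).hom = (homologyIsoQ M n).hom ≫
      (DerivedCategory.homologyFunctor (ModuleCat.{u} A) n).map (DerivedCategory.Q.map g) :=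
  (DerivedCategory.homologyFunctorFactors (ModuleCat.{u} A) n).inv.naturality g

/-- The map from the cycles of degree zero of a complex to the homology of its image in the derived
category. -/
def cyclesToHomology (M : CochainComplex (ModuleCat.{u} A) ℤ) :
    M.cycles 0 ⟶ (DerivedCategory.homologyFunctor (ModuleCat.{u} A) 0).obj
      (DerivedCategory.Q.obj M) :=
  M.homologyπ 0 ≫ (homologyIsoQ M 0).hom

lemma cyclesToHomology_naturality {M N : CochainComplex (ModuleCat.{u} A) ℤ} (g : M ⟶ N) :
    HomologicalComplex.cyclesMap g 0 ≫ cyclesToHomology N =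
      cyclesToHomology M ≫ (DerivedCategory.homologyFunctor (ModuleCat.{u} A) 0).map
        (DerivedCategory.Q.map g) := by
  rw [cyclesToHomology, cyclesToHomology, ← Category.assoc,
    ← HomologicalComplex.homologyπ_naturality,
    Category.assoc, homologyIsoQ_naturality, Category.assoc]

/-- Two morphisms from a complex to an injective module in degree zero which agree on cycles agree
in the derived category. -/
lemma Q_map_eq_of_cycles {M : CochainComplex (ModuleCat.{u} A) ℤ} {J : ModuleCat.{u} A}
    [Injective J] (f g : M ⟶ singleZero.obj J)
    (h : M.iCycles 0 ≫ f.f 0 = M.iCycles 0 ≫ g.f 0) :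
    DerivedCategory.Q.map f = DerivedCategory.Q.map g := by
  have hS : (ShortComplex.mk (M.iCycles 0) (M.d 0 1) (M.iCycles_d 0 1)).Exact :=
    ShortComplex.exact_of_f_is_kernel _ (M.cyclesIsKernel 0 1 (by simp))
  have : Injective ((singleZero.obj J).X 0) := inferInstanceAs (Injective J)
  -- The difference vanishes on cycles, so it factors through the image of `d` in degree 1.
  -- Injectivity extends it to all of `M.X 1`, and the extension is a null-homotopy.
  let k : M.X 1 ⟶ (singleZero.obj J).X 0 := hS.descToInjective (f.f 0 - g.f 0) (by
    change M.iCycles 0 ≫ _ = 0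
    rw [Preadditive.comp_sub, h, sub_self])
  have hk : M.d 0 1 ≫ k = f.f 0 - g.f 0 := hS.comp_descToInjective _ _
  let φ (i j : ℤ) (hij : (ComplexShape.up ℤ).Rel j i) : M.X i ⟶ (singleZero.obj J).X j :=
    if hj : j = 0 then (M.XIsoOfEq (by
      have : j + 1 = i := hij
      omega)).hom ≫ k ≫ ((singleZero.obj J).XIsoOfEq hj).inv else 0
  have hφ : f - g = Homotopy.nullHomotopicMap' φ := by
    refine HomologicalComplex.to_single_hom_ext ?_
    rw [Homotopy.nullHomotopicMap'_f (show (ComplexShape.up ℤ).Rel (-1) 0 by simp)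
      (show (ComplexShape.up ℤ).Rel 0 1 by simp), HomologicalComplex.single_obj_d, comp_zero,
      add_zero]
    simp [φ, hk]
  have hQ : DerivedCategory.Q.map (f - g) = 0 :=
    (DerivedCategory.Q_map_eq_of_homotopy _ ((Homotopy.ofEq hφ).trans
      (Homotopy.nullHomotopy' φ))).trans (Functor.map_zero _ _ _)
  rwa [Functor.map_sub, sub_eq_zero] at hQ

/-- A homomorphism from the homology of degree zero to an injective module is induced by a morphism
of complexes. -/
lemma exists_hom_single {M : CochainComplex (ModuleCat.{u} A) ℤ} {J : ModuleCat.{u} A}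
    [Injective J] (φ : (DerivedCategory.homologyFunctor (ModuleCat.{u} A) 0).obj
      (DerivedCategory.Q.obj M) ⟶ J) : ∃ f : M ⟶ singleZero.obj J,
    M.iCycles 0 ≫ f.f 0 = cyclesToHomology M ≫ φ ≫
      (HomologicalComplex.singleObjXSelf (ComplexShape.up ℤ) 0 J).inv := by
  let k := Injective.factorThru (cyclesToHomology M ≫ φ) (M.iCycles 0)
  have hk : M.iCycles 0 ≫ k = cyclesToHomology M ≫ φ := Injective.comp_factorThru _ _
  refine ⟨HomologicalComplex.mkHomToSingle k fun i hi => ?_, ?_⟩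
  · rw [← M.toCycles_i i 0, Category.assoc, hk, cyclesToHomology, ← Category.assoc, ← Category.assoc,
      M.toCycles_comp_homologyπ, zero_comp, zero_comp]
  · rw [HomologicalComplex.mkHomToSingle_f, ← Category.assoc, hk, Category.assoc]

end ToSingle

/-! ### A natural map in `D(A)` to injective modules in degree zero, split at `E`. -/

section InjectiveHull

variable {A : Type u} [Ring A] [HasDerivedCategory.{w} (ModuleCat.{u} A)] (E : ModuleCat.{u} A)

/-- The functor sending an object `M` of the derived category to the product of copies of `E`
indexed by the homomorphisms from `H^0(M)` to `E`, in degree zero. -/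
def dualPowerHomology : DerivedCategory (ModuleCat.{u} A) ⥤ DerivedCategory (ModuleCat.{u} A) :=
  DerivedCategory.homologyFunctor (ModuleCat.{u} A) 0 ⋙ dualPower E ⋙ singleZero ⋙
    DerivedCategory.Q

variable [Injective E]

/-- A morphism of complexes which represents the evaluation of the homology of degree zero. -/
def dualPowerHomologyHom (M : CochainComplex (ModuleCat.{u} A) ℤ) :
    M ⟶ singleZero.obj ((dualPower E).obj
      ((DerivedCategory.homologyFunctor (ModuleCat.{u} A) 0).obj (DerivedCategory.Q.obj M))) :=
  (exists_hom_single ((dualPowerUnit E).app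
    ((DerivedCategory.homologyFunctor (ModuleCat.{u} A) 0).obj (DerivedCategory.Q.obj M)))).choose

lemma iCycles_dualPowerHomologyHom (M : CochainComplex (ModuleCat.{u} A) ℤ) :
    M.iCycles 0 ≫ (dualPowerHomologyHom E M).f 0 = cyclesToHomology M ≫ (dualPowerUnit E).app
      ((DerivedCategory.homologyFunctor (ModuleCat.{u} A) 0).obj (DerivedCategory.Q.obj M)) ≫
        (HomologicalComplex.singleObjXSelf (ComplexShape.up ℤ) 0 _).inv :=
  (exists_hom_single ((dualPowerUnit E).app
    ((DerivedCategory.homologyFunctor (ModuleCat.{u} A) 0).obj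
      (DerivedCategory.Q.obj M)))).choose_spec

/-- The natural morphism from the functor `DerivedCategory.Q` given by `dualPowerHomologyHom`. -/
def complexDualPowerHomologyUnit : DerivedCategory.Q ⟶
    DerivedCategory.Q ⋙ dualPowerHomology E where
  app M := DerivedCategory.Q.map (dualPowerHomologyHom E M)
  naturality M N g := by
    refine (DerivedCategory.Q.map_comp _ _).symm.trans
      (Eq.trans ?_ (DerivedCategory.Q.map_comp _ _))
    -- The morphisms `dualPowerHomologyHom` are chosen separately for each complex, so the square
    -- need not commute on complexes. In `D(A)` it suffices to compare on cycles, where the chosen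
    -- morphisms are prescribed.
    refine Q_map_eq_of_cycles _ _ ?_
    let H := DerivedCategory.homologyFunctor (ModuleCat.{u} A) 0
    have h₁ : (dualPowerUnit E).app (H.obj (DerivedCategory.Q.obj M)) ≫
        (dualPower E).map (H.map (DerivedCategory.Q.map g)) =
        H.map (DerivedCategory.Q.map g) ≫ (dualPowerUnit E).app (H.obj (DerivedCategory.Q.obj N)) :=
      ((dualPowerUnit E).naturality (H.map (DerivedCategory.Q.map g))).symm
    rw [HomologicalComplex.comp_f, HomologicalComplex.comp_f, ← Category.assoc, ← Category.assoc,
      ← HomologicalComplex.cyclesMap_i, Category.assoc, iCycles_dualPowerHomologyHom,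
      iCycles_dualPowerHomologyHom, ← Category.assoc, cyclesToHomology_naturality, Category.assoc,
      Category.assoc, Category.assoc, singleObjXSelf_inv_map, ← Category.assoc (H.map _), ← h₁,
      Category.assoc]

/-- The natural morphism from the identity functor to `dualPowerHomology`. -/
def dualPowerHomologyUnit : 𝟭 _ ⟶ dualPowerHomology E :=
  Localization.liftNatTrans DerivedCategory.Q
    (HomologicalComplex.quasiIso (ModuleCat.{u} A) (ComplexShape.up ℤ)) DerivedCategory.Q
    (DerivedCategory.Q ⋙ dualPowerHomology E) (𝟭 _) (dualPowerHomology E)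
    (complexDualPowerHomologyUnit E)

lemma dualPowerHomologyUnit_app (M : CochainComplex (ModuleCat.{u} A) ℤ) :
    (dualPowerHomologyUnit E).app (DerivedCategory.Q.obj M) =
      DerivedCategory.Q.map (dualPowerHomologyHom E M) :=
  (Localization.liftNatTrans_app _ _ _ _ _ _ _ M).trans
    ((Category.id_comp _).trans (Category.comp_id _))

/-- The retraction is the projection to the factor indexed by the canonical map `H⁰(E) ≅ E`. -/
lemma exists_retraction_dualPowerHomologyUnit :
    ∃ r, (dualPowerHomologyUnit E).app (DerivedCategory.Q.obj (singleZero.obj E)) ≫ r = 𝟙 _ := by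
  let θ : (DerivedCategory.homologyFunctor (ModuleCat.{u} A) 0).obj
      (DerivedCategory.Q.obj (singleZero.obj E)) ⟶ E :=
    (homologyIsoQ (singleZero.obj E) 0).inv ≫
      (HomologicalComplex.singleObjHomologySelfIso (ComplexShape.up ℤ) 0 E).hom
  have hθ : cyclesToHomology (singleZero.obj E) ≫ θ =
      (HomologicalComplex.singleObjCyclesSelfIso (ComplexShape.up ℤ) 0 E).hom := by
    dsimp only [θ, cyclesToHomology]
    rw [Category.assoc, Iso.hom_inv_id_assoc]
    exact HomologicalComplex.homologyπ_singleObjHomologySelfIso_hom _ _ _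
  refine ⟨DerivedCategory.Q.map (singleZero.map (dualPowerProj E _ θ)), ?_⟩
  rw [dualPowerHomologyUnit_app]
  refine (DerivedCategory.Q.map_comp _ _).symm.trans
    (Eq.trans ?_ (DerivedCategory.Q.map_id _))
  refine Q_map_eq_of_cycles _ _ ?_
  rw [HomologicalComplex.comp_f, ← Category.assoc, iCycles_dualPowerHomologyHom, Category.assoc,
    Category.assoc, singleObjXSelf_inv_map, ← Category.assoc ((dualPowerUnit E).app _),
    dualPowerUnit_proj, ← Category.assoc, hθ, HomologicalComplex.singleObjCyclesSelfIso_hom]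
  simp

end InjectiveHull

/-! ### Vanishing of derived functors on injectives from the universal property alone. -/

section Acyclicity

variable {A : Type u} [Ring A] [HasDerivedCategory.{w} (ModuleCat.{u} A)]

lemma isLE_map_singleZero (F : ModuleCat.{u} A ⥤ ModuleCat.{u} A) [F.Additive]
    (M : ModuleCat.{u} A) : (DerivedCategory.Q.obj
      ((F.mapHomologicalComplex (ComplexShape.up ℤ)).obj (singleZero.obj M))).IsLE 0 := by
  have : CochainComplex.IsStrictlyLE
      ((F.mapHomologicalComplex (ComplexShape.up ℤ)).obj (singleZero.obj M)) 0 := by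
    rw [CochainComplex.isStrictlyLE_iff]
    intro i hi
    exact F.map_isZero (HomologicalComplex.isZero_single_obj_X _ _ _ _ (by omega))
  infer_instance

/-- The values of a right derived functor on injective modules have no homology in positive
degrees. -/
lemma isZero_homology_rightDerived_obj {F : ModuleCat.{u} A ⥤ ModuleCat.{u} A} [F.Additive]
    (RF : RightDerived.{w} F) (E : ModuleCat.{u} A) [Injective E] (n : ℤ) (hn : 1 ≤ n) :
    IsZero ((DerivedCategory.homologyFunctor (ModuleCat.{u} A) n).obj
      (RF.functor.obj (DerivedCategory.Q.obj (singleZero.obj E)))) := by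
  let t : Triangulated.TStructure (DerivedCategory (ModuleCat.{u} A)) := DerivedCategory.TStructure.t
  let I := dualPowerHomology E
  -- The universal property only concerns transformations out of `RF`. Hence the vanishing at `E` is
  -- first encoded in a transformation to the truncation `τ≥1` of `RF` at injective modules, which
  -- can be tested after composition with the unit.
  let c : RF.functor ⟶ (I ⋙ RF.functor) ⋙ t.truncGE 1 :=
    Functor.whiskerRight (dualPowerHomologyUnit E) RF.functor ≫
      Functor.whiskerLeft (I ⋙ RF.functor) (t.truncGEπ 1)
  have hc : c = 0 := by
    refine RF.functor.rightDerived_ext RF.unit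
      (HomologicalComplex.quasiIso (ModuleCat.{u} A) (ComplexShape.up ℤ)) _ _ _ ?_
    ext M : 2
    let N := singleZero.obj ((dualPower E).obj
      ((DerivedCategory.homologyFunctor (ModuleCat.{u} A) 0).obj (DerivedCategory.Q.obj M)))
    have h₁ : RF.unit.app M ≫ RF.functor.map (DerivedCategory.Q.map (dualPowerHomologyHom E M)) =
        DerivedCategory.Q.map ((F.mapHomologicalComplex (ComplexShape.up ℤ)).map
          (dualPowerHomologyHom E M)) ≫ RF.unit.app N :=
      (RF.unit.naturality (dualPowerHomologyHom E M)).symm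
    -- `F N` sits in degree zero, and there are no nonzero morphisms from `D≤0` to `D≥1`.
    have h₂ : RF.unit.app N ≫ (t.truncGEπ 1).app (RF.functor.obj (DerivedCategory.Q.obj N)) = 0 :=
      t.zero_of_isLE_of_isGE _ 0 1 (by omega) (isLE_map_singleZero F _)
        (inferInstanceAs (t.IsGE ((t.truncGE 1).obj (RF.functor.obj (DerivedCategory.Q.obj N))) 1))
    have h₃ : RF.unit.app M ≫ RF.functor.map ((dualPowerHomologyUnit E).app
        (DerivedCategory.Q.obj M)) ≫ (t.truncGEπ 1).app (RF.functor.obj (DerivedCategory.Q.obj N)) =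
        0 := by
      rw [dualPowerHomologyUnit_app]
      refine (Category.assoc _ _ _).symm.trans ((congrArg (· ≫ _) h₁).trans ?_)
      rw [Category.assoc, h₂, comp_zero]
    exact h₃.trans comp_zero.symm
  let X := RF.functor.obj (I.obj (DerivedCategory.Q.obj (singleZero.obj E)))
  let H := DerivedCategory.homologyFunctor (ModuleCat.{u} A) n
  have h₁ : RF.functor.map ((dualPowerHomologyUnit E).app
      (DerivedCategory.Q.obj (singleZero.obj E))) ≫ (t.truncGEπ 1).app X = 0 :=
    congrArg (fun τ => τ.app (DerivedCategory.Q.obj (singleZero.obj E))) hc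
  have h₂ : Mono (H.map ((t.truncGEπ 1).app X)) := by
    refine (DerivedCategory.HomologySequence.mono_homologyMap_mor₂_iff _
      (t.triangleLTGE_distinguished 1 X) n).2 ?_
    have : DerivedCategory.IsLE ((t.triangleLTGE 1).obj X).obj₁ 0 :=
      inferInstanceAs (t.IsLE ((t.triangleLTGE 1).obj X).obj₁ (1 - 1))
    exact (DerivedCategory.isZero_of_isLE _ 0 n (by omega)).eq_of_src _ _
  have h₃ : H.map (RF.functor.map ((dualPowerHomologyUnit E).app
      (DerivedCategory.Q.obj (singleZero.obj E)))) = 0 := by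
    rw [← cancel_mono (H.map ((t.truncGEπ 1).app X)), ← Functor.map_comp, h₁, Functor.map_zero,
      zero_comp]
  -- The map shown to vanish on `Hⁿ` has a retraction, so its source is zero.
  obtain ⟨r, hr⟩ := exists_retraction_dualPowerHomologyUnit E
  rw [IsZero.iff_id_eq_zero]
  have h₄ := congrArg (fun f => H.map (RF.functor.map f)) hr
  have h₅ : H.map (RF.functor.map ((dualPowerHomologyUnit E).app
      (DerivedCategory.Q.obj (singleZero.obj E)) ≫ r)) = 0 := by
    rw [Functor.map_comp, Functor.map_comp, h₃, zero_comp]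
  refine Eq.trans ?_ (h₄.symm.trans h₅)
  exact ((congrArg H.map (RF.functor.map_id _)).trans (H.map_id _)).symm

end Acyclicity

/-! ### The implication (iv) → (iii). -/

section TensorToSurjective

variable {𝕂 : Type v} [CommRing 𝕂] {A : Type u} [Ring A] [Algebra 𝕂 A]
  (S : Submonoid A) [OreLocalization.OreSet S]

/-- Under these hypotheses every pair `(0, y)` is a cycle of the fiber in degree `j`, and the
boundaries are the pairs whose `y` comes from `M.X i`. Thus the homology in degree `j` is the
cokernel of the localisation map of `M.X i`. -/
lemma localizationUnit_surjective_of_isZero_homology (M : CochainComplex (ModuleCat.{u} A) ℤ)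
    (i j : ℤ) (hij : i + 1 = j) (hM : IsZero (M.X j))
    (h : IsZero (((complexTensor (localizationComplex 𝕂 S)).obj M).homology j))
    (hM' : M.d (i - 1) i = 0) :
    Function.Surjective ((localizationUnit 𝕂 S).app (M.X i)) := by
  have h₁ : IsZero ((fiber (complexLocalizationUnitApp 𝕂 S M)).homology j) :=
    h.of_iso ((HomologicalComplex.homologyFunctor _ _ j).mapIso ((tensorIsoFiber 𝕂 S).app M)).symm
  rw [← HomologicalComplex.exactAt_iff_isZero_homology, HomologicalComplex.exactAt_iff' _ i j (j + 1)
    (by simp; omega) (by simp), ShortComplex.moduleCat_exact_iff] at h₁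
  intro (y : ((complexLocalization 𝕂 S).obj M).X i)
  have hd : ((complexLocalization 𝕂 S).obj M).d i j = 0 :=
    (congrArg (localizationFunctor 𝕂 S).map (hM.eq_of_tgt (M.d i j) 0)).trans (Functor.map_zero _ _ _)
  have hd' : ((complexLocalization 𝕂 S).obj M).d (i - 1) i = 0 :=
    (congrArg (localizationFunctor 𝕂 S).map hM').trans (Functor.map_zero _ _ _)
  obtain ⟨z, hz⟩ := h₁ (fiberEquiv (complexLocalizationUnitApp 𝕂 S M) i j hij (0, y)) (by
    refine (fiber_d _ i j (j + 1) hij rfl _ _).trans ?_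
    exact (fiberEquiv_eq_zero_iff _ j (j + 1) rfl _ _).2 ⟨map_zero (M.d j (j + 1)).hom,
      (congrArg₂ (· - ·) (map_zero ((complexLocalizationUnitApp 𝕂 S M).f j).hom)
        (congrArg (fun f => f.hom y) hd)).trans (sub_zero _)⟩)
  obtain ⟨x, y', rfl⟩ := exists_eq_fiberEquiv (complexLocalizationUnitApp 𝕂 S M) (i - 1) i
    (by omega) z
  have h₂ := (fiber_d (complexLocalizationUnitApp 𝕂 S M) (i - 1) i j (by omega) hij x y').symm.trans hz
  have h₃ := ((fiberEquiv_eq_iff _ i j hij _ _ _ _).1 h₂).2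
  have h₄ : ((complexLocalization 𝕂 S).obj M).d (i - 1) i y' = 0 :=
    congrArg (fun f => f.hom y') hd'
  rw [h₄, sub_zero] at h₃
  exact ⟨x, h₃⟩

variable [HasDerivedCategory.{w} (ModuleCat.{u} A)]

/-- The cokernel of `E → E_S` is `H¹(K(A;S) ⊗ E)`. The counit is invertible because `K(A;S) ⊗ (-)`
preserves quasi-isomorphisms, so `ν` identifies this with `H¹(RΓ_S E)`, which vanishes. -/
lemma surjective_toLocalization_of_derivedTorsionIsTensor (h : DerivedTorsionIsTensor.{w} 𝕂 S)
    (E : ModuleCat.{u} A) (hE : Injective E) : Function.Surjective (toLocalization S E) := by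
  obtain ⟨RΓ, KL, ν, -, hν⟩ := h
  have hKL : IsIso KL.counit :=
    Functor.isIso_of_isLeftDerivedFunctor_of_inverts KL.functor KL.counit
      (isInvertedBy_complexTensor 𝕂 S)
  let H := DerivedCategory.homologyFunctor (ModuleCat.{u} A) 1
  let e := (asIso ν).app (DerivedCategory.Q.obj (singleZero.obj E)) ≪≫
    (asIso KL.counit).app (singleZero.obj E)
  have h₁ : IsZero (((complexTensor (localizationComplex 𝕂 S)).obj (singleZero.obj E)).homology 1) :=
    (isZero_homology_rightDerived_obj RΓ E 1 le_rfl).of_iso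
      (homologyIsoQ _ 1 ≪≫ H.mapIso e.symm)
  have h₂ := localizationUnit_surjective_of_isZero_homology S (singleZero.obj E) 0 1 rfl
    (HomologicalComplex.isZero_single_obj_X _ _ _ _ one_ne_zero) h₁ (by simp)
  rw [localizationUnit_app_surjective_iff] at h₂
  let f := (HomologicalComplex.singleObjXSelf (ComplexShape.up ℤ) 0 E).hom
  exact toLocalization_surjective_of_surjective f.hom
    ((ModuleCat.epi_iff_surjective f).1 inferInstance) h₂

end TensorToSurjective

end OreTorsion

end

theorem theorem4p2 (𝕂 : Type v) [CommRing 𝕂] (A : Type u) [Ring A] [Algebra 𝕂 A]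
    [HasDerivedCategory.{w} (ModuleCat.{u} A)]
    (S : Submonoid A) [OreLocalization.OreSet S] :
    List.TFAE [
      OreTorsion.IsWeaklyStable (OreTorsion.oreTorsionClass S),
      ∀ M : ModuleCat.{u} A, OreTorsion.IsRightAcyclic (OreTorsion.oreTorsionFunctor S) M →
        Function.Surjective (OreTorsion.toLocalization S M),
      ∀ E : ModuleCat.{u} A, Injective E → Function.Surjective (OreTorsion.toLocalization S E),
      OreTorsion.DerivedTorsionIsTensor.{w} 𝕂 S,
      OreTorsion.rightCohomologicalDimension (OreTorsion.oreTorsionFunctor S) ≤ 1] := by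
  tfae_have 1 → 3 := OreTorsion.surjective_toLocalization_of_isWeaklyStable S
  tfae_have 3 → 1 := OreTorsion.isWeaklyStable_of_surjective S
  tfae_have 3 → 5 := fun h => (OreTorsion.rightCohomologicalDimension_le_one_iff S).2
    fun n hn M => OreTorsion.isZero_rightDerived_of_surjective S h M n hn
  tfae_have 5 → 2 := fun h M hM => OreTorsion.surjective_toLocalization_of_isZero S M (hM 1 le_rfl)
    ((OreTorsion.rightCohomologicalDimension_le_one_iff S).1 h 2 le_rfl _)
  tfae_have 2 → 3 := fun h E hE => h E (OreTorsion.isRightAcyclic_of_injective S E hE)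
  tfae_have 3 → 4 := OreTorsion.derivedTorsionIsTensor_of_surjective 𝕂 S
  tfae_have 4 → 3 := OreTorsion.surjective_toLocalization_of_derivedTorsionIsTensor S
  tfae_finish
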